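/- Let $a(n), v(n)$, $n\ge 1$, be real numbers with $a(n)\neq 0$ for all $n\geq 1$ and $\sum_{n\ge1}|a(n)|^{-1}=\infty$. Let $H_+$ be the self-adjoint operator on $\ell^2(\{1,2,3,\dots\})$ given by $$(H_+\psi)(n)=a(n)\psi(n+1)+a(n-1)\psi(n-1)+v(n)\psi(n),\qquad \psi(0)=0,$$ (so that the value of $a(0)$ is immaterial) on its natural domain $\{\psi\in\ell^2: H_+\psi\in\ell^2\}$. Let $P_S$ denote the spectral projection of $H_+$ on a Borel set $S\subset\mathbb R$, and let $\mu^+(S)=\langle P_S\delta_1,\delta_1\rangle$ be the spectral measure of $\delta_1$. For $E\in\mathbb R$ let $u_0(\cdot,E)$ be the solution of $a(n)u(n+1)+a(n-1)u(n-1)+v(n)u(n)=E\,u(n)$, $n\ge1$, with $u(0)=0$, $u(1)=1$. For $L\ge0$ put $$\|\varphi\|_L^2=\sum_{n=1}^{\lfloor L\rfloor}|\varphi(n)|^2+(L-\lfloor L\rfloor)\,|\varphi(\lfloor L\rfloor+1)|^2,$$ and for $T>0$ put $\langle A(t)\rangle_T=\frac2T\int_0^\infty e^{-2t/T}A(t)\,dt$.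 **Theorem 1.4.** Let $\alpha,\gamma:\mathbb R\to\mathbb R$ be Borel measurable functions such that for $\mu^+$-almost every $E$ $$\limsup_{\epsilon\downarrow0}\frac{\mu^+((E-\epsilon,E+\epsilon))}{(2\epsilon)^{\alpha(E)}}<\infty\qquad\text{and}\qquad \limsup_{L\to\infty}L^{-\gamma(E)}\|u_0(\cdot,E)\|_L^2<\infty ,$$ and let $\eta(E)=\alpha(E)/\gamma(E)$ (with $\eta(E)=0$ where $\gamma(E)=0$). Let $b>0$ and let $S\subset\mathbb R$ be a Borel set such that $\eta(E)\geq b$ for all $E\in S$. Then for every $g>0$ there exists a constant $C_g>0$ such that for all $T>0$ $$\left\langle \|e^{-iH_+t}P_S\delta_1\|^2_{C_gT^b}\right\rangle_T\le 1-\mu^+\left(\{E:\eta(E)\ge b\}\right)+g .$$ -/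

import Mathlib

open Set Filter Topology MeasureTheory
open scoped ENNReal

noncomputable section

/-! ### Spectral calculus of an unbounded self-adjoint operator -/

namespace SpectralCalc

variable {𝓗 : Type*} [NormedAddCommGroup 𝓗] [InnerProductSpace ℂ 𝓗] [CompleteSpace 𝓗]

/-- `P` is a projection-valued Borel measure on `ℝ` (its values on non-Borel sets are irrelevant). -/
structure IsPVM (P : Set ℝ → 𝓗 →L[ℂ] 𝓗) : Prop where
  selfAdjoint : ∀ S, MeasurableSet S → IsSelfAdjoint (P S)
  inter : ∀ S S', MeasurableSet S → MeasurableSet S' → P (S ∩ S') = P S * P S'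
  empty : P ∅ = 0
  univ : P Set.univ = 1
  iUnion : ∀ S : ℕ → Set ℝ, (∀ i, MeasurableSet (S i)) → Pairwise (Function.onFun Disjoint S) →
    ∀ ψ : 𝓗, HasSum (fun i => P (S i) ψ) (P (⋃ i, S i) ψ)

/-- `S ↦ ⟨P(S)ψ, ψ⟩`, with values in `[0, ∞]`. -/
def pvmMass (P : Set ℝ → 𝓗 →L[ℂ] 𝓗) (ψ : 𝓗) (S : Set ℝ) : ℝ≥0∞ :=
  ENNReal.ofReal (inner ℂ ψ (P S ψ)).re

theorem pvmMass_nonneg {P : Set ℝ → 𝓗 →L[ℂ] 𝓗} (hP : IsPVM P) (ψ : 𝓗) {S : Set ℝ}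
    (hS : MeasurableSet S) : 0 ≤ (inner ℂ ψ (P S ψ)).re := by
  have h1 : P S ψ = P S (P S ψ) := by
    have h := hP.inter S S hS hS
    rw [Set.inter_self] at h
    exact congrArg (fun B : 𝓗 →L[ℂ] 𝓗 => B ψ) h
  have h2 : inner ℂ ψ (P S (P S ψ)) = inner ℂ (P S ψ) (P S ψ) := by
    rw [← ContinuousLinearMap.adjoint_inner_left]
    have h := hP.selfAdjoint S hS
    rw [ContinuousLinearMap.isSelfAdjoint_iff'] at h
    rw [h]
  rw [h1, h2]
  exact inner_self_nonneg (𝕜 := ℂ)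

theorem pvmMass_iUnion {P : Set ℝ → 𝓗 →L[ℂ] 𝓗} (hP : IsPVM P) (ψ : 𝓗) (S : ℕ → Set ℝ)
    (hS : ∀ i, MeasurableSet (S i)) (hd : Pairwise (Function.onFun Disjoint S)) :
    pvmMass P ψ (⋃ i, S i) = ∑' i, pvmMass P ψ (S i) := by
  have h1 := hP.iUnion S hS hd ψ
  have h2 : HasSum (fun i => (inner ℂ ψ (P (S i) ψ)).re) (inner ℂ ψ (P (⋃ i, S i) ψ)).re :=
    Complex.hasSum_re (h1.mapL (innerSL ℂ ψ))
  unfold pvmMass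
  rw [← h2.tsum_eq]
  exact ENNReal.ofReal_tsum_of_nonneg (fun i => pvmMass_nonneg hP ψ (hS i)) h2.summable

open Classical in
/-- The scalar measure `μ_ψ(S) = ⟨P(S)ψ, ψ⟩` of a projection-valued measure
(zero if `P` is not a projection-valued measure). -/
def pvmMeasure (P : Set ℝ → 𝓗 →L[ℂ] 𝓗) (ψ : 𝓗) : Measure ℝ :=
  if hP : IsPVM P then
    Measure.ofMeasurable (fun S _ => pvmMass P ψ S)
      (by simp [pvmMass, hP.empty])
      (fun S hS hd => pvmMass_iUnion hP ψ S hS hd)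
  else 0

theorem pvmMeasure_apply {P : Set ℝ → 𝓗 →L[ℂ] 𝓗} (hP : IsPVM P) (ψ : 𝓗) {S : Set ℝ}
    (hS : MeasurableSet S) :
    pvmMeasure P ψ S = ENNReal.ofReal (inner ℂ ψ (P S ψ)).re := by
  rw [pvmMeasure, dif_pos hP, Measure.ofMeasurable_apply S hS, pvmMass]

/-- `P` is the spectral resolution of the operator `A`: it is a projection-valued measure and
`A = ∫ x dP(x)`, that is, the domain of `A` is the set of `ψ` with `∫ x² dμ_ψ(x) < ∞`, and
`⟨Aψ, ψ⟩ = ∫ x dμ_ψ(x)` there. By the spectral theorem every self-adjoint operator has exactly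
one spectral resolution (as a function on Borel sets). -/
structure IsSpectralResolution (A : 𝓗 →ₗ.[ℂ] 𝓗) (P : Set ℝ → 𝓗 →L[ℂ] 𝓗) : Prop where
  isPVM : IsPVM P
  mem_domain : ∀ ψ : 𝓗, ψ ∈ A.domain ↔ ∫⁻ x, ENNReal.ofReal (x ^ 2) ∂(pvmMeasure P ψ) < ⊤
  inner_apply : ∀ ψ : A.domain,
    inner ℂ (ψ : 𝓗) (A ψ) = ((∫ x, x ∂(pvmMeasure P (ψ : 𝓗)) : ℝ) : ℂ)

open Classical in
/-- The spectral projections `P_S` of a self-adjoint operator `A`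
(zero if `A` has no spectral resolution, i.e. is not self-adjoint). -/
def spectralProj (A : 𝓗 →ₗ.[ℂ] 𝓗) : Set ℝ → 𝓗 →L[ℂ] 𝓗 :=
  if h : ∃ P, IsSpectralResolution A P then h.choose else 0

/-- The spectral measure `μ_ψ` of the vector `ψ` for the self-adjoint operator `A`:
`μ_ψ(S) = ⟨P_S ψ, ψ⟩`. -/
def spectralMeasure (A : 𝓗 →ₗ.[ℂ] 𝓗) (ψ : 𝓗) : Measure ℝ :=
  pvmMeasure (spectralProj A) ψ

open Classical in
/-- The bounded operator `f(A)` for a bounded Borel function `f`: the unique bounded operator `B`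
with `⟨Bψ, ψ⟩ = ∫ f dμ_ψ` for all vectors `ψ`. -/
def functionOf (A : 𝓗 →ₗ.[ℂ] 𝓗) (f : ℝ → ℂ) : 𝓗 →L[ℂ] 𝓗 :=
  if h : ∃ B : 𝓗 →L[ℂ] 𝓗, ∀ ψ : 𝓗, inner ℂ ψ (B ψ) = ∫ x, f x ∂(spectralMeasure A ψ)
  then h.choose else 0

/-- The Schrödinger evolution `e^{-iAt}`. -/
def evolution (A : 𝓗 →ₗ.[ℂ] 𝓗) (t : ℝ) : 𝓗 →L[ℂ] 𝓗 :=
  functionOf A fun x => Complex.exp (-Complex.I * (x : ℂ) * (t : ℂ))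

end SpectralCalc

/-! ### Jacobi operators on the half-line `{1, 2, 3, …}` -/

namespace HalfLine

/-- `ℓ²` of the half-line `{1, 2, 3, …}`; the coordinate with index `k : ℕ` is the value at the
site `k + 1`. -/
abbrev L2 : Type := lp (fun _ : ℕ => ℂ) 2

/-- The value of `ψ` at the site `n`, with the Dirichlet convention `ψ(0) = 0`. -/
def atSite (ψ : ℕ → ℂ) : ℕ → ℂ
  | 0 => 0
  | k + 1 => ψ k

/-- The unit vector `δ₁`, supported at the site `1`. -/
def delta1 : L2 := lp.single 2 0 (1 : ℂ)

/-- The Jacobi difference expression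
`(Hψ)(n) = a(n) ψ(n+1) + a(n-1) ψ(n-1) + v(n) ψ(n)` with `ψ(0) = 0`, evaluated at `n = k + 1`. -/
def jacobiExpr (a v : ℕ → ℝ) (ψ : ℕ → ℂ) (k : ℕ) : ℂ :=
  (a (k + 1) : ℂ) * atSite ψ (k + 2) + (a k : ℂ) * atSite ψ k + (v (k + 1) : ℂ) * atSite ψ (k + 1)

theorem jacobiExpr_add (a v : ℕ → ℝ) (ψ φ : ℕ → ℂ) :
    jacobiExpr a v (ψ + φ) = jacobiExpr a v ψ + jacobiExpr a v φ := by
  funext k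
  cases k <;> simp only [jacobiExpr, atSite, Pi.add_apply] <;> ring

theorem jacobiExpr_smul (a v : ℕ → ℝ) (c : ℂ) (ψ : ℕ → ℂ) :
    jacobiExpr a v (c • ψ) = c • jacobiExpr a v ψ := by
  funext k
  cases k <;> simp only [jacobiExpr, atSite, Pi.smul_apply, smul_eq_mul] <;> ring

theorem jacobiExpr_zero (a v : ℕ → ℝ) : jacobiExpr a v 0 = 0 := by
  funext k
  cases k <;> simp [jacobiExpr, atSite]

/-- The half-line operator `H₊` with Dirichlet boundary condition, on its natural domain
`{ψ ∈ ℓ² : Hψ ∈ ℓ²}`. -/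
def jacobiOp (a v : ℕ → ℝ) : L2 →ₗ.[ℂ] L2 where
  domain :=
    { carrier := {ψ | Memℓp (jacobiExpr a v ψ) 2}
      add_mem' := by
        intro ψ φ hψ hφ
        have h := Memℓp.add hψ hφ
        rw [← jacobiExpr_add] at h
        exact h
      zero_mem' := by
        have h : Memℓp (0 : ℕ → ℂ) 2 := zero_memℓp
        rw [← jacobiExpr_zero a v] at h
        exact h
      smul_mem' := by
        intro c ψ hψ
        have h := Memℓp.const_smul hψ c
        rw [← jacobiExpr_smul] at h
        exact h }
  toFun :=
    { toFun := fun ψ => ⟨jacobiExpr a v (ψ : L2), ψ.2⟩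
      map_add' := fun ψ φ => Subtype.ext (jacobiExpr_add a v _ _)
      map_smul' := fun c ψ => Subtype.ext (jacobiExpr_smul a v c _) }

/-- The spectral measure `μ⁺` of `H₊`, i.e. the spectral measure of `δ₁`. -/
def muPlus (a v : ℕ → ℝ) : Measure ℝ :=
  SpectralCalc.spectralMeasure (jacobiOp a v) delta1

/-- The solution `u₀(·, E)` of `a(n) u(n+1) + a(n-1) u(n-1) + v(n) u(n) = E u(n)`, `n ≥ 1`,
with `u(0) = 0` and `u(1) = 1`. -/
def dirichletSol (a v : ℕ → ℝ) (E : ℝ) : ℕ → ℝ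
  | 0 => 0
  | 1 => 1
  | n + 2 => ((E - v (n + 1)) * dirichletSol a v E (n + 1) - a n * dirichletSol a v E n) / a (n + 1)

/-- The truncated norm squared
`‖φ‖_L² = ∑_{n=1}^{⌊L⌋} |φ(n)|² + (L - ⌊L⌋) |φ(⌊L⌋ + 1)|²`, for `L ≥ 0`. -/
def truncNormSq {F : Type*} [Norm F] (φ : ℕ → F) (L : ℝ) : ℝ :=
  ∑ n ∈ Finset.Icc 1 ⌊L⌋₊, ‖φ n‖ ^ 2 + (L - (⌊L⌋₊ : ℝ)) * ‖φ (⌊L⌋₊ + 1)‖ ^ 2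

/-- The time average `⟨A(t)⟩_T = (2/T) ∫₀^∞ e^{-2t/T} A(t) dt`. -/
def timeAvg (A : ℝ → ℝ) (T : ℝ) : ℝ :=
  2 / T * ∫ t in Set.Ioi (0 : ℝ), Real.exp (-2 * t / T) * A t

/-- The upper `s`-derivative `D^s μ(E) = limsup_{ε ↓ 0} μ((E-ε, E+ε)) / (2ε)^s`. -/
def upperDeriv (μ : Measure ℝ) (s E : ℝ) : ℝ≥0∞ :=
  limsup (fun ε : ℝ => μ (Set.Ioo (E - ε) (E + ε)) / ENNReal.ofReal ((2 * ε) ^ s)) (𝓝[>] 0)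

end HalfLine

end

/-!
For bounded `B`, the vector `P_B δ₁` has an expansion in the generalized eigenfunctions,
`(P_B δ₁)(n) = ∫_B u₀(n, E) dμ⁺(E)`, as both sides satisfy the recursion for `u₀`. Time averaging
`|∫_B e^{-itE} u₀(n, E) dμ⁺(E)|²` replaces the oscillating factor by a Lorentzian of width `1/T`,
so by `2xy ≤ x² + y²`
`⟨‖e^{-itH₊} P_B δ₁‖_L²⟩_T ≤ ∫_B ‖u₀(·, E)‖_L² K_T(E) dμ⁺(E)`,
where `K_T(E)` is the `μ⁺`-mass within about `1/T` of `E`, of order `T^{-α(E)}` because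
`α(E) ≤ 1 < 2` almost everywhere. With `L = r T^b` the integrand is of order
`r^{min(γ(E), 1)} T^{bγ(E) - α(E)}`, which is small uniformly in `T ≥ 1` when `r` is small, as
`b γ(E) ≤ α(E)`; when `T ≤ 1`, the ball contains only a fraction `r T^b` of the first site.
The choice of `r` depends on `E`, but a single `r` works for all energies outside a set of small
`μ⁺`-measure, whose contribution is bounded by that measure.
-/

/-! ### The bounded functional calculus of a projection-valued measure -/

theorem exists_simpleFunc_dist_le {X E : Type*} [MeasurableSpace X] [PseudoMetricSpace E]
    [ProperSpace E] [Nonempty E] [MeasurableSpace E] [OpensMeasurableSpace E] {f : X → E}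
    (hf : Measurable f) (hb : Bornology.IsBounded (range f)) {ε : ℝ} (hε : 0 < ε) :
    ∃ s : SimpleFunc X E, ∀ x, dist (s x) (f x) ≤ ε := by
  let e := TopologicalSpace.denseSeq E
  obtain ⟨t, ht⟩ := hb.isCompact_closure.elim_finite_subcover (fun k => Metric.ball (e k) ε)
    (fun _ => Metric.isOpen_ball) fun y _ => by
      obtain ⟨k, hk⟩ := (TopologicalSpace.denseRange_denseSeq E).exists_dist_lt y hε
      exact mem_iUnion.mpr ⟨k, hk⟩
  refine ⟨(SimpleFunc.nearestPt e (t.sup id)).comp f hf, fun x => ?_⟩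
  obtain ⟨k, hk, hxk⟩ := mem_iUnion₂.mp (ht (subset_closure (mem_range_self x)))
  have h := SimpleFunc.edist_nearestPt_le e (f x) (Finset.le_sup (f := id) hk)
  rw [edist_dist, edist_dist, ENNReal.ofReal_le_ofReal_iff dist_nonneg] at h
  rw [Metric.mem_ball, dist_comm] at hxk
  exact h.trans hxk.le

namespace SpectralCalc

variable {𝓗 : Type*} [NormedAddCommGroup 𝓗] [InnerProductSpace ℂ 𝓗] {P : Set ℝ → 𝓗 →L[ℂ] 𝓗}

/-- The integral `∑ y, y P(s = y)` of a simple function against a projection-valued measure. -/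
noncomputable def simpleIntegral (P : Set ℝ → 𝓗 →L[ℂ] 𝓗) (s : SimpleFunc ℝ ℂ) : 𝓗 →L[ℂ] 𝓗 :=
  ∑ y ∈ s.range, y • P (s ⁻¹' {y})

theorem inner_simpleIntegral (s : SimpleFunc ℝ ℂ) (φ ψ : 𝓗) {m : Measure ℝ} {w : ℝ → ℂ}
    (hw : Integrable w m) (h : ∀ B, MeasurableSet B → inner ℂ φ (P B ψ) = ∫ x in B, w x ∂m) :
    inner ℂ φ (simpleIntegral P s ψ) = ∫ x, s x * w x ∂m := by
  have hsum : ∀ x, s x * w x = ∑ y ∈ s.range, (s ⁻¹' {y}).indicator (fun x => y * w x) x := by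
    intro x
    rw [Finset.sum_eq_single_of_mem (s x) (s.mem_range_self x)]
    · rw [indicator_of_mem (by simp)]
    · exact fun y _ hy => indicator_of_notMem (fun h => hy h.symm) _
  simp_rw [hsum]
  rw [integral_finsetSum _ fun y _ => (hw.const_mul y).indicator (s.measurableSet_fiber y),
    simpleIntegral, sum_apply, inner_sum]
  refine Finset.sum_congr rfl fun y _ => ?_
  rw [smul_apply, inner_smul_right, h _ (s.measurableSet_fiber y),
    integral_indicator (s.measurableSet_fiber y), integral_const_mul]

theorem inner_eq_integral_of_tendsto {f : ℝ → ℂ} (hf : Measurable f) {c : ℝ}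
    (hc : ∀ x, ‖f x‖ ≤ c) {s : ℕ → SimpleFunc ℝ ℂ}
    (hs : ∀ n x, ‖s n x - f x‖ ≤ (1 / 2) ^ n) {Q : 𝓗 →L[ℂ] 𝓗}
    (hQ : Tendsto (fun n => simpleIntegral P (s n)) atTop (𝓝 Q)) {φ ψ : 𝓗} {m : Measure ℝ}
    {w : ℝ → ℂ} (hw : Integrable w m)
    (h : ∀ B, MeasurableSet B → inner ℂ φ (P B ψ) = ∫ x in B, w x ∂m) :
    inner ℂ φ (Q ψ) = ∫ x, f x * w x ∂m := by
  have hpow : Tendsto (fun n : ℕ => (1 / 2 : ℝ) ^ n) atTop (𝓝 0) :=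
    tendsto_pow_atTop_nhds_zero_of_lt_one (by norm_num) (by norm_num)
  have hinner : Tendsto (fun n => inner ℂ φ (simpleIntegral P (s n) ψ)) atTop
      (𝓝 (inner ℂ φ (Q ψ))) :=
    tendsto_const_nhds.inner (((ContinuousLinearMap.apply ℂ 𝓗 ψ).continuous.tendsto Q).comp hQ)
  refine tendsto_nhds_unique hinner ?_
  simp only [inner_simpleIntegral _ φ ψ hw h]
  refine tendsto_iff_norm_sub_tendsto_zero.mpr <| squeeze_zero (fun _ => norm_nonneg _)
    (g := fun n => (1 / 2) ^ n * ∫ x, ‖w x‖ ∂m) (fun n => ?_) (by simpa using hpow.mul_const _)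
  have hfw : Integrable (fun x => f x * w x) m :=
    hw.bdd_mul hf.aestronglyMeasurable (ae_of_all _ hc)
  have hsw : Integrable (fun x => s n x * w x) m :=
    hw.bdd_mul (s n).measurable.aestronglyMeasurable (ae_of_all _ fun x =>
      (norm_le_norm_add_norm_sub' _ _).trans (add_le_add (hc x) (hs n x)))
  rw [← integral_sub hsw hfw, ← integral_const_mul]
  refine norm_integral_le_of_norm_le (hw.norm.const_mul _) (ae_of_all _ fun x => ?_)
  rw [← sub_mul, norm_mul]
  exact mul_le_mul_of_nonneg_right (hs n x) (norm_nonneg _)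

variable [CompleteSpace 𝓗]

instance isFiniteMeasure_pvmMeasure (ψ : 𝓗) : IsFiniteMeasure (pvmMeasure P ψ) := by
  by_cases hP : IsPVM P
  · exact ⟨by rw [pvmMeasure_apply hP ψ .univ]; exact ENNReal.ofReal_lt_top⟩
  · rw [pvmMeasure, dif_neg hP]
    infer_instance

namespace IsPVM

theorem inner_left (hP : IsPVM P) {B : Set ℝ} (hB : MeasurableSet B) (φ ψ : 𝓗) :
    inner ℂ (P B φ) ψ = inner ℂ φ (P B ψ) :=
  (hP.selfAdjoint B hB).isSymmetric φ ψ

theorem apply_apply (hP : IsPVM P) {B C : Set ℝ} (hB : MeasurableSet B) (hC : MeasurableSet C)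
    (ψ : 𝓗) : P B (P C ψ) = P (B ∩ C) ψ := by
  rw [hP.inter B C hB hC]
  rfl

theorem inner_self_apply (hP : IsPVM P) {B : Set ℝ} (hB : MeasurableSet B) (ψ : 𝓗) :
    inner ℂ ψ (P B ψ) = ((pvmMeasure P ψ).real B : ℂ) := by
  rw [Measure.real, pvmMeasure_apply hP ψ hB, ENNReal.toReal_ofReal (pvmMass_nonneg hP ψ hB)]
  refine (Complex.conj_eq_iff_re.mp ?_).symm
  rw [inner_conj_symm, hP.inner_left hB]

theorem norm_sq_apply (hP : IsPVM P) {B : Set ℝ} (hB : MeasurableSet B) (ψ : 𝓗) :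
    ‖P B ψ‖ ^ 2 = (pvmMeasure P ψ).real B := by
  have h : (‖P B ψ‖ ^ 2 : ℂ) = ((pvmMeasure P ψ).real B : ℂ) := by
    rw [← hP.inner_self_apply hB, ← Complex.coe_algebraMap, ← inner_self_eq_norm_sq_to_K,
      hP.inner_left hB, hP.apply_apply hB hB, inter_self]
  exact_mod_cast h

theorem pvmMeasure_real_univ (hP : IsPVM P) (ψ : 𝓗) : (pvmMeasure P ψ).real Set.univ = ‖ψ‖ ^ 2 := by
  rw [← hP.norm_sq_apply .univ, hP.univ, one_apply_eq_self]

theorem pvmMeasure_apply_proj (hP : IsPVM P) {B : Set ℝ} (hB : MeasurableSet B) (ψ : 𝓗) :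
    pvmMeasure P (P B ψ) = (pvmMeasure P ψ).restrict B := by
  ext C hC
  rw [Measure.restrict_apply hC, pvmMeasure_apply hP _ hC, pvmMeasure_apply hP _ (hC.inter hB),
    hP.inner_left hB, hP.apply_apply hC hB, hP.apply_apply hB (hC.inter hB),
    inter_eq_right.mpr inter_subset_right]

theorem apply_union (hP : IsPVM P) {B C : Set ℝ} (hB : MeasurableSet B) (hC : MeasurableSet C)
    (hBC : Disjoint B C) (ψ : 𝓗) : P (B ∪ C) ψ = P B ψ + P C ψ := by
  have hμ : ∀ χ : 𝓗, (pvmMeasure P χ).real (B ∪ C)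
      = (pvmMeasure P χ).real B + (pvmMeasure P χ).real C := fun χ =>
    measureReal_union hBC hC
  have h : (P (B ∪ C) : 𝓗 →ₗ[ℂ] 𝓗) = (P B + P C : 𝓗 →L[ℂ] 𝓗) := by
    refine (ext_inner_map _ _).mp fun χ => ?_
    simp only [ContinuousLinearMap.coe_coe, add_apply, inner_add_left,
      hP.inner_left hB, hP.inner_left hC, hP.inner_left (hB.union hC), hP.inner_self_apply hB,
      hP.inner_self_apply hC, hP.inner_self_apply (hB.union hC), hμ, Complex.ofReal_add]
  exact LinearMap.congr_fun h ψ

theorem tendsto_apply_Icc (hP : IsPVM P) (ψ : 𝓗) :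
    Tendsto (fun N : ℕ => P (Icc (-(N : ℝ)) N) ψ) atTop (𝓝 ψ) := by
  have hμ : Tendsto (fun N : ℕ => (pvmMeasure P ψ).real (Icc (-(N : ℝ)) N)ᶜ) atTop (𝓝 0) := by
    have hanti : Antitone fun N : ℕ => (Icc (-(N : ℝ)) N)ᶜ := fun M N hMN =>
      compl_subset_compl.mpr (Icc_subset_Icc (by simpa using hMN) (by simpa using hMN))
    have hempty : ⋂ N : ℕ, (Icc (-(N : ℝ)) N)ᶜ = ∅ := by
      rw [← compl_iUnion, compl_empty_iff, eq_univ_iff_forall]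
      intro x
      obtain ⟨N, hN⟩ := exists_nat_ge |x|
      exact mem_iUnion.mpr ⟨N, abs_le.mp hN⟩
    have h := tendsto_measure_iInter_atTop (μ := pvmMeasure P ψ)
      (fun N : ℕ => (measurableSet_Icc (a := -(N : ℝ)) (b := N)).compl.nullMeasurableSet) hanti
      ⟨0, measure_ne_top _ _⟩
    rw [hempty, measure_empty] at h
    exact (ENNReal.tendsto_toReal ENNReal.zero_ne_top).comp h
  rw [tendsto_iff_norm_sub_tendsto_zero]
  have hdiff : ∀ N : ℕ, ‖P (Icc (-(N : ℝ)) N) ψ - ψ‖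
      = √((pvmMeasure P ψ).real (Icc (-(N : ℝ)) N)ᶜ) := by
    intro N
    have h := hP.apply_union (measurableSet_Icc (a := -(N : ℝ)) (b := N))
      measurableSet_Icc.compl disjoint_compl_right ψ
    rw [union_compl_self, hP.univ, one_apply_eq_self] at h
    rw [← hP.norm_sq_apply measurableSet_Icc.compl, Real.sqrt_sq (norm_nonneg _), norm_sub_rev,
      sub_eq_of_eq_add' h]
  simpa only [hdiff, Real.sqrt_zero] using hμ.sqrt

end IsPVM

theorem IsPVM.norm_simpleIntegral_apply_sq (hP : IsPVM P) (s : SimpleFunc ℝ ℂ) (ψ : 𝓗) :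
    ‖simpleIntegral P s ψ‖ ^ 2 = ∫ x, ‖s x‖ ^ 2 ∂(pvmMeasure P ψ) := by
  have hint : Integrable s (pvmMeasure P ψ) := SimpleFunc.integrable_of_isFiniteMeasure s
  have hproj : ∀ B, MeasurableSet B →
      inner ℂ (simpleIntegral P s ψ) (P B ψ)
        = ∫ x in B, (starRingEnd ℂ) (s x) ∂(pvmMeasure P ψ) := by
    intro B hB
    have h := inner_simpleIntegral (P := P) s (P B ψ) ψ (m := (pvmMeasure P ψ).restrict B)
      (w := fun _ => 1) (integrable_const _) fun C hC => by
        rw [hP.inner_left hB, hP.apply_apply hB hC, hP.inner_self_apply (hB.inter hC),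
          setIntegral_const, measureReal_restrict_apply hC, inter_comm]
        simp
    rw [← inner_conj_symm, h, ← integral_conj]
    simp only [mul_one]
  have h := inner_simpleIntegral s _ ψ (Complex.conjCLE.toContinuousLinearMap.integrable_comp hint)
    hproj
  simp only [ContinuousLinearEquiv.coe_coe, Complex.conjCLE_apply, Complex.mul_conj,
    Complex.normSq_eq_norm_sq] at h
  rw [inner_self_eq_norm_sq_to_K, integral_complex_ofReal] at h
  exact Complex.ofReal_injective ((Complex.ofReal_pow _ _).trans h)

/-- `Q = ∫ f dP` as a quadratic form: `⟨χ, Qχ⟩ = ∫ f dμ_χ` for all `χ`. As the space is complex,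
this determines `Q`. -/
def IsSpectralIntegral (P : Set ℝ → 𝓗 →L[ℂ] 𝓗) (f : ℝ → ℂ) (Q : 𝓗 →ₗ[ℂ] 𝓗) : Prop :=
  ∀ χ : 𝓗, inner ℂ χ (Q χ) = ∫ x, f x ∂(pvmMeasure P χ)

theorem IsSpectralIntegral.unique {f : ℝ → ℂ} {Q R : 𝓗 →ₗ[ℂ] 𝓗} (hQ : IsSpectralIntegral P f Q)
    (hR : IsSpectralIntegral P f R) : Q = R :=
  (ext_inner_map Q R).mp fun χ => by
    rw [← inner_conj_symm, hQ χ, ← hR χ, inner_conj_symm]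

theorem IsPVM.isSpectralIntegral_simpleIntegral (hP : IsPVM P) (s : SimpleFunc ℝ ℂ) :
    IsSpectralIntegral P s (simpleIntegral P s : 𝓗 →L[ℂ] 𝓗) := fun χ => by
  rw [ContinuousLinearMap.coe_coe, inner_simpleIntegral s χ χ (w := fun _ => 1)
    (integrable_const (μ := pvmMeasure P χ) _) fun B hB => by
      simp [hP.inner_self_apply hB]]
  simp only [mul_one]

theorem IsPVM.simpleIntegral_sub (hP : IsPVM P) (s t : SimpleFunc ℝ ℂ) :
    simpleIntegral P (s - t) = simpleIntegral P s - simpleIntegral P t := by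
  refine ContinuousLinearMap.coe_injective <|
    (hP.isSpectralIntegral_simpleIntegral (s - t)).unique fun χ => ?_
  have hs := hP.isSpectralIntegral_simpleIntegral s χ
  have ht := hP.isSpectralIntegral_simpleIntegral t χ
  rw [ContinuousLinearMap.coe_coe] at hs ht ⊢
  rw [sub_apply, inner_sub_right, hs, ht, ← integral_sub
    (SimpleFunc.integrable_of_isFiniteMeasure s) (SimpleFunc.integrable_of_isFiniteMeasure t)]
  rfl

theorem IsPVM.norm_simpleIntegral_le (hP : IsPVM P) (s : SimpleFunc ℝ ℂ) {c : ℝ}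
    (hs : ∀ x, ‖s x‖ ≤ c) : ‖simpleIntegral P s‖ ≤ c := by
  have hc : 0 ≤ c := (norm_nonneg _).trans (hs 0)
  refine ContinuousLinearMap.opNorm_le_bound _ hc fun ψ => ?_
  refine le_of_sq_le_sq ?_ (by positivity)
  calc ‖simpleIntegral P s ψ‖ ^ 2 = ∫ x, ‖s x‖ ^ 2 ∂(pvmMeasure P ψ) :=
        hP.norm_simpleIntegral_apply_sq s ψ
    _ ≤ ∫ _, c ^ 2 ∂(pvmMeasure P ψ) :=
        integral_mono_of_nonneg (ae_of_all _ fun x => by positivity) (integrable_const _)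
          (ae_of_all _ fun x => pow_le_pow_left₀ (norm_nonneg _) (hs x) 2)
    _ = (c * ‖ψ‖) ^ 2 := by
        rw [integral_const, hP.pvmMeasure_real_univ, smul_eq_mul]
        ring

theorem IsPVM.exists_tendsto_simpleIntegral (hP : IsPVM P) {f : ℝ → ℂ} (hf : Measurable f) {c : ℝ}
    (hc : ∀ x, ‖f x‖ ≤ c) :
    ∃ (s : ℕ → SimpleFunc ℝ ℂ) (Q : 𝓗 →L[ℂ] 𝓗), (∀ n x, ‖s n x - f x‖ ≤ (1 / 2) ^ n) ∧
      Tendsto (fun n => simpleIntegral P (s n)) atTop (𝓝 Q) := by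
  have hb : Bornology.IsBounded (range f) :=
    isBounded_iff_forall_norm_le.mpr ⟨c, forall_mem_range.mpr hc⟩
  choose s hs using fun n : ℕ =>
    exists_simpleFunc_dist_le hf hb (ε := (1 / 2) ^ n) (by positivity)
  simp only [dist_eq_norm] at hs
  have hdist : ∀ n, dist (simpleIntegral P (s n)) (simpleIntegral P (s (n + 1)))
      ≤ 2 * (1 / 2) ^ n := by
    intro n
    rw [dist_eq_norm, ← hP.simpleIntegral_sub]
    refine hP.norm_simpleIntegral_le _ fun x => ?_
    calc ‖s n x - s (n + 1) x‖ = ‖(s n x - f x) - (s (n + 1) x - f x)‖ := by ring_nf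
      _ ≤ (1 / 2) ^ n + (1 / 2) ^ (n + 1) :=
          (norm_sub_le _ _).trans (add_le_add (hs n x) (hs (n + 1) x))
      _ ≤ 2 * (1 / 2) ^ n := by
          rw [pow_succ]
          linarith [pow_pos (one_half_pos (α := ℝ)) n]
  obtain ⟨Q, hQ⟩ := cauchySeq_tendsto_of_complete
    (cauchySeq_of_le_geometric (1 / 2) 2 (by norm_num) hdist)
  exact ⟨s, Q, hs, hQ⟩

theorem IsPVM.isSpectralIntegral_of_tendsto (hP : IsPVM P) {f : ℝ → ℂ} (hf : Measurable f) {c : ℝ}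
    (hc : ∀ x, ‖f x‖ ≤ c) {s : ℕ → SimpleFunc ℝ ℂ} (hs : ∀ n x, ‖s n x - f x‖ ≤ (1 / 2) ^ n)
    {Q : 𝓗 →L[ℂ] 𝓗} (hQ : Tendsto (fun n => simpleIntegral P (s n)) atTop (𝓝 Q)) :
    IsSpectralIntegral P f (Q : 𝓗 →ₗ[ℂ] 𝓗) := fun χ => by
  rw [ContinuousLinearMap.coe_coe, inner_eq_integral_of_tendsto hf hc hs hQ (w := fun _ => 1)
    (integrable_const (μ := pvmMeasure P χ) _) fun B hB => by simp [hP.inner_self_apply hB]]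
  simp only [mul_one]

theorem IsPVM.exists_isSpectralIntegral (hP : IsPVM P) {f : ℝ → ℂ} (hf : Measurable f) {c : ℝ}
    (hc : ∀ x, ‖f x‖ ≤ c) : ∃ Q : 𝓗 →L[ℂ] 𝓗, IsSpectralIntegral P f (Q : 𝓗 →ₗ[ℂ] 𝓗) := by
  obtain ⟨s, Q, hs, hQ⟩ := hP.exists_tendsto_simpleIntegral hf hc
  exact ⟨Q, hP.isSpectralIntegral_of_tendsto hf hc hs hQ⟩

namespace IsSpectralIntegral

theorem exists_tendsto_simpleIntegral (hP : IsPVM P) {f : ℝ → ℂ} (hf : Measurable f)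
    {c : ℝ} (hc : ∀ x, ‖f x‖ ≤ c) {Q : 𝓗 →ₗ[ℂ] 𝓗} (hQ : IsSpectralIntegral P f Q) :
    ∃ (s : ℕ → SimpleFunc ℝ ℂ) (R : 𝓗 →L[ℂ] 𝓗), (∀ n x, ‖s n x - f x‖ ≤ (1 / 2) ^ n) ∧
      Tendsto (fun n => simpleIntegral P (s n)) atTop (𝓝 R) ∧ Q = R := by
  obtain ⟨s, R, hs, hR⟩ := hP.exists_tendsto_simpleIntegral hf hc
  exact ⟨s, R, hs, hR, hQ.unique (hP.isSpectralIntegral_of_tendsto hf hc hs hR)⟩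

theorem inner_eq_integral (hP : IsPVM P) {f : ℝ → ℂ} (hf : Measurable f) {c : ℝ}
    (hc : ∀ x, ‖f x‖ ≤ c) {Q : 𝓗 →ₗ[ℂ] 𝓗} (hQ : IsSpectralIntegral P f Q) {φ ψ : 𝓗}
    {m : Measure ℝ} {w : ℝ → ℂ} (hw : Integrable w m)
    (h : ∀ B, MeasurableSet B → inner ℂ φ (P B ψ) = ∫ x in B, w x ∂m) :
    inner ℂ φ (Q ψ) = ∫ x, f x * w x ∂m := by
  obtain ⟨s, R, hs, hR, rfl⟩ := exists_tendsto_simpleIntegral hP hf hc hQ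
  exact inner_eq_integral_of_tendsto hf hc hs hR hw h

theorem norm_apply_le (hP : IsPVM P) {f : ℝ → ℂ} (hf : Measurable f) {c : ℝ}
    (hc : ∀ x, ‖f x‖ ≤ c) {Q : 𝓗 →ₗ[ℂ] 𝓗} (hQ : IsSpectralIntegral P f Q) (ψ : 𝓗) :
    ‖Q ψ‖ ≤ c * ‖ψ‖ := by
  obtain ⟨s, R, hs, hR, rfl⟩ := exists_tendsto_simpleIntegral hP hf hc hQ
  have hpow : Tendsto (fun n : ℕ => c + (1 / 2 : ℝ) ^ n) atTop (𝓝 c) := by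
    simpa using (tendsto_pow_atTop_nhds_zero_of_lt_one (r := (1 / 2 : ℝ)) (by norm_num)
      (by norm_num)).const_add c
  have hnorm : ‖R‖ ≤ c := le_of_tendsto_of_tendsto' hR.norm hpow fun n =>
    hP.norm_simpleIntegral_le _ fun x =>
      (norm_le_norm_add_norm_sub' _ _).trans (add_le_add (hc x) (hs n x))
  exact R.le_of_opNorm_le hnorm ψ

end IsSpectralIntegral

theorem isSpectralResolution_spectralProj {A : 𝓗 →ₗ.[ℂ] 𝓗} (hA : ∃ P, IsSpectralResolution A P) :
    IsSpectralResolution A (spectralProj A) := by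
  rw [spectralProj, dif_pos hA]
  exact hA.choose_spec

theorem norm_exp_neg_I_mul (x t : ℝ) : ‖Complex.exp (-Complex.I * (x : ℂ) * (t : ℂ))‖ = 1 := by
  rw [show -Complex.I * (x : ℂ) * (t : ℂ) = ((-(x * t) : ℝ) : ℂ) * Complex.I by push_cast; ring]
  exact Complex.norm_exp_ofReal_mul_I _

theorem measurable_exp_neg_I_mul (t : ℝ) :
    Measurable fun x : ℝ => Complex.exp (-Complex.I * (x : ℂ) * (t : ℂ)) :=
  Continuous.measurable (by fun_prop)

theorem isSpectralIntegral_evolution {A : 𝓗 →ₗ.[ℂ] 𝓗} (hA : ∃ P, IsSpectralResolution A P)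
    (t : ℝ) : IsSpectralIntegral (spectralProj A)
      (fun x => Complex.exp (-Complex.I * (x : ℂ) * (t : ℂ))) (evolution A t : 𝓗 →ₗ[ℂ] 𝓗) := by
  have h := (isSpectralResolution_spectralProj hA).isPVM.exists_isSpectralIntegral
    (measurable_exp_neg_I_mul t) fun x => (norm_exp_neg_I_mul x t).le
  rw [evolution, functionOf]
  exact (dif_pos h).symm ▸ h.choose_spec

theorem norm_evolution_le {A : 𝓗 →ₗ.[ℂ] 𝓗} (hA : ∃ P, IsSpectralResolution A P) (t : ℝ) (ψ : 𝓗) :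
    ‖evolution A t ψ‖ ≤ ‖ψ‖ := by
  simpa only [one_mul, ContinuousLinearMap.coe_coe] using
    (isSpectralIntegral_evolution hA t).norm_apply_le (isSpectralResolution_spectralProj hA).isPVM
      (measurable_exp_neg_I_mul t) (fun x => (norm_exp_neg_I_mul x t).le) ψ

namespace IsSpectralResolution

theorem proj_mem_domain {A : 𝓗 →ₗ.[ℂ] 𝓗} (h : IsSpectralResolution A P) {B : Set ℝ}
    (hB : MeasurableSet B) {R : ℝ} (hBR : B ⊆ Icc (-R) R) (ψ : 𝓗) : P B ψ ∈ A.domain := by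
  rw [h.mem_domain, h.isPVM.pvmMeasure_apply_proj hB]
  refine (setLIntegral_mono' hB fun x hx => ENNReal.ofReal_le_ofReal
    (sq_le_sq' (hBR hx).1 (hBR hx).2)).trans_lt ?_
  rw [setLIntegral_const]
  exact ENNReal.mul_lt_top ENNReal.ofReal_lt_top (measure_lt_top _ _)

-- A spectral resolution determines `A` only through its quadratic form; the polarization is done
-- on the bounded compressions `P_J A P_J`.
theorem isSpectralIntegral_compress {A : 𝓗 →ₗ.[ℂ] 𝓗} (h : IsSpectralResolution A P)
    {J : Set ℝ} (hJ : MeasurableSet J) (hdom : ∀ χ, P J χ ∈ A.domain) :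
    IsSpectralIntegral P (J.indicator fun x => (x : ℂ))
      (P J ∘ₗ A.toFun ∘ₗ (P J : 𝓗 →ₗ[ℂ] 𝓗).codRestrict A.domain hdom) := fun χ => by
  have hχ := h.inner_apply ⟨P J χ, hdom χ⟩
  rw [h.isPVM.pvmMeasure_apply_proj hJ, ← integral_complex_ofReal, ← integral_indicator hJ] at hχ
  rw [← hχ, h.isPVM.inner_left hJ]
  rfl

theorem inner_apply_eq_integral {A : 𝓗 →ₗ.[ℂ] 𝓗} (h : IsSpectralResolution A P) {R : ℝ}
    {ψ : A.domain} (hψ : P (Icc (-R) R) ψ = ψ) {φ : 𝓗} {m : Measure ℝ} {w : ℝ → ℂ}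
    (hw : Integrable w m) (hxw : Integrable (fun x => x * w x) m)
    (hφψ : ∀ B, MeasurableSet B → inner ℂ φ (P B ψ) = ∫ x in B, w x ∂m) :
    inner ℂ φ (A ψ) = ∫ x, x * w x ∂m := by
  let J : ℕ → Set ℝ := fun N => Icc (-(N : ℝ)) N
  have hJ : ∀ N, MeasurableSet (J N) := fun N => measurableSet_Icc
  have hinner : Tendsto (fun N => inner ℂ (P (J N) φ) (A ψ)) atTop (𝓝 (inner ℂ φ (A ψ))) :=
    (h.isPVM.tendsto_apply_Icc φ).inner tendsto_const_nhds
  have hint : Tendsto (fun N => ∫ x in J N, x * w x ∂m) atTop (𝓝 (∫ x, x * w x ∂m)) :=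
    (aecover_Icc (tendsto_neg_atTop_atBot.comp tendsto_natCast_atTop_atTop)
      tendsto_natCast_atTop_atTop).integral_tendsto_of_countably_generated hxw
  refine tendsto_nhds_unique hinner (hint.congr' ?_)
  filter_upwards [eventually_ge_atTop ⌈R⌉₊] with N hN
  have hRN : R ≤ N := Nat.ceil_le.mp hN
  have hψN : P (J N) ψ = ψ := by
    rw [← hψ, h.isPVM.apply_apply (hJ N) measurableSet_Icc, inter_eq_right.mpr]
    exact Icc_subset_Icc (neg_le_neg hRN) hRN
  have hdom := h.proj_mem_domain (hJ N) subset_rfl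
  have hQ := (h.isSpectralIntegral_compress (hJ N) hdom).inner_eq_integral h.isPVM
    (Complex.measurable_ofReal.indicator (hJ N)) (c := N) (fun x => by
      by_cases hx : x ∈ J N
      · simpa [hx] using abs_le.mpr hx
      · simp [hx]) hw hφψ
  have hQψ : (P (J N) ∘ₗ A.toFun ∘ₗ (P (J N) : 𝓗 →ₗ[ℂ] 𝓗).codRestrict A.domain hdom) ψ
      = P (J N) (A ψ) := congrArg (fun χ => P (J N) (A χ)) (Subtype.ext hψN)
  rw [h.isPVM.inner_left (hJ N), ← hQψ, hQ, ← integral_indicator (hJ N)]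
  simp only [indicator_mul_left]

end IsSpectralResolution

end SpectralCalc

/-! ### Expansion of `P_B δ₁` in the solutions `u₀(·, E)` -/

namespace HalfLine

open SpectralCalc

instance isFiniteMeasure_muPlus (a v : ℕ → ℝ) : IsFiniteMeasure (muPlus a v) :=
  isFiniteMeasure_pvmMeasure _

theorem continuous_dirichletSol (a v : ℕ → ℝ) (n : ℕ) :
    Continuous fun E => dirichletSol a v E n := by
  induction n using Nat.strong_induction_on with
  | _ n ih =>
    match n with
    | 0 => exact continuous_const
    | 1 => exact continuous_const
    | k + 2 =>
      have h₁ := ih (k + 1) (by omega)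
      have h₂ := ih k (by omega)
      simp only [dirichletSol]
      fun_prop

theorem dirichletSol_recursion {a : ℕ → ℝ} (v : ℕ → ℝ) (ha : ∀ n, 1 ≤ n → a n ≠ 0) (E : ℝ) (k : ℕ) :
    a (k + 1) * dirichletSol a v E (k + 2) = E * dirichletSol a v E (k + 1)
      - (v (k + 1) * dirichletSol a v E (k + 1) + a k * dirichletSol a v E k) := by
  rw [dirichletSol, mul_div_cancel₀ _ (ha (k + 1) (by omega))]
  ring

theorem integrableOn_ofReal_of_continuous {f : ℝ → ℝ} (hf : Continuous f) {μ : Measure ℝ}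
    [IsFiniteMeasureOnCompacts μ] {B : Set ℝ} {R : ℝ} (hBR : B ⊆ Icc (-R) R) :
    IntegrableOn (fun E => (f E : ℂ)) B μ :=
  ((Complex.continuous_ofReal.comp hf).continuousOn.integrableOn_compact isCompact_Icc).mono_set hBR

theorem inner_single_eq_atSite (k : ℕ) (ψ : L2) :
    inner ℂ (lp.single 2 k (1 : ℂ) : L2) ψ = atSite ψ (k + 1) := by
  rw [lp.inner_single_left]
  simp [atSite]

variable {a v : ℕ → ℝ} {P : Set ℝ → L2 →L[ℂ] L2}

theorem jacobiExpr_proj_delta1 (hP : IsSpectralResolution (jacobiOp a v) P) {R : ℝ} {B : Set ℝ}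
    (hB : MeasurableSet B) (hBR : B ⊆ Icc (-R) R) {k : ℕ} {u : ℝ → ℝ} (hu : Continuous u)
    (hsite : ∀ C, MeasurableSet C → C ⊆ B →
      atSite (P C delta1) (k + 1) = ∫ E in C, (u E : ℂ) ∂(pvmMeasure P delta1)) :
    jacobiExpr a v (P B delta1) k = ∫ E in B, ((E * u E : ℝ) : ℂ) ∂(pvmMeasure P delta1) := by
  have hdom := hP.proj_mem_domain hB hBR delta1
  have hsupp : P (Icc (-R) R) (P B delta1) = P B delta1 := by
    rw [hP.isPVM.apply_apply measurableSet_Icc hB, inter_eq_right.mpr hBR]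
  have hxu := integrableOn_ofReal_of_continuous (μ := pvmMeasure P delta1)
    (continuous_id.mul hu) hBR
  simp only [Complex.ofReal_mul, id, Pi.mul_apply] at hxu ⊢
  rw [← hP.inner_apply_eq_integral (ψ := ⟨P B delta1, hdom⟩) (φ := lp.single 2 k (1 : ℂ)) hsupp
    (integrableOn_ofReal_of_continuous hu hBR) hxu, inner_single_eq_atSite]
  · rfl
  · intro C hC
    rw [hP.isPVM.apply_apply hC hB, inner_single_eq_atSite, Measure.restrict_restrict hC,
      hsite _ (hC.inter hB) inter_subset_right]

theorem atSite_proj_delta1 (ha : ∀ n, 1 ≤ n → a n ≠ 0)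
    (hP : IsSpectralResolution (jacobiOp a v) P) {R : ℝ} (n : ℕ) {B : Set ℝ} (hB : MeasurableSet B)
    (hBR : B ⊆ Icc (-R) R) :
    atSite (P B delta1) n = ∫ E in B, (dirichletSol a v E n : ℂ) ∂(pvmMeasure P delta1) := by
  induction n using Nat.strong_induction_on generalizing B with
  | _ n ih =>
    match n with
    | 0 => simp [atSite, dirichletSol]
    | 1 =>
      rw [← inner_single_eq_atSite]
      exact (hP.isPVM.inner_self_apply hB delta1).trans (by simp [dirichletSol])
    | k + 2 =>
      have hint : ∀ f : ℝ → ℝ, Continuous f → IntegrableOn (fun E => (f E : ℂ)) B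
        (pvmMeasure P delta1) := fun f hf => integrableOn_ofReal_of_continuous hf hBR
      have hu := continuous_dirichletSol a v
      have hH := jacobiExpr_proj_delta1 hP hB hBR (hu (k + 1)) fun C hC hCB =>
        ih (k + 1) (by omega) hC (hCB.trans hBR)
      refine mul_left_cancel₀ (Complex.ofReal_ne_zero.mpr (ha (k + 1) (by omega))) ?_
      calc (a (k + 1) : ℂ) * atSite (P B delta1) (k + 2)
          = jacobiExpr a v (P B delta1) k - (v (k + 1) * atSite (P B delta1) (k + 1)
              + a k * atSite (P B delta1) k) := by
            rw [jacobiExpr]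
            ring
        _ = ∫ E in B, ((E * dirichletSol a v E (k + 1)
              - (v (k + 1) * dirichletSol a v E (k + 1) + a k * dirichletSol a v E k) : ℝ) : ℂ)
              ∂(pvmMeasure P delta1) := by
            rw [hH, ih k (by omega) hB hBR, ih (k + 1) (by omega) hB hBR, ← integral_const_mul,
              ← integral_const_mul, ← integral_add ((hint _ (hu _)).const_mul _)
              ((hint _ (hu _)).const_mul _), ← integral_sub]
            · push_cast
              rfl
            · exact hint _ (continuous_id.mul (hu (k + 1)))
            · exact ((hint _ (hu _)).const_mul _).add ((hint _ (hu _)).const_mul _)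
        _ = (a (k + 1) : ℂ) * ∫ E in B, (dirichletSol a v E (k + 2) : ℂ)
              ∂(pvmMeasure P delta1) := by
            simp only [← dirichletSol_recursion v ha, Complex.ofReal_mul, integral_const_mul]

theorem atSite_evolution_proj_delta1 (ha : ∀ n, 1 ≤ n → a n ≠ 0)
    (hA : ∃ P, IsSpectralResolution (jacobiOp a v) P) {R : ℝ} (n : ℕ) {B : Set ℝ}
    (hB : MeasurableSet B) (hBR : B ⊆ Icc (-R) R) (t : ℝ) :
    atSite (evolution (jacobiOp a v) t (spectralProj (jacobiOp a v) B delta1)) n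
      = ∫ E in B, Complex.exp (-Complex.I * (E : ℂ) * (t : ℂ)) * (dirichletSol a v E n : ℂ)
        ∂(muPlus a v) := by
  have hP := isSpectralResolution_spectralProj hA
  cases n with
  | zero => simp [atSite, dirichletSol]
  | succ k =>
    rw [← inner_single_eq_atSite]
    refine (isSpectralIntegral_evolution hA t).inner_eq_integral hP.isPVM
      (measurable_exp_neg_I_mul t) (fun x => (norm_exp_neg_I_mul x t).le)
      (integrableOn_ofReal_of_continuous (μ := pvmMeasure _ delta1)
        (continuous_dirichletSol a v (k + 1)) hBR) fun C hC => ?_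
    rw [hP.isPVM.apply_apply hC hB, inner_single_eq_atSite, Measure.restrict_restrict hC,
      atSite_proj_delta1 ha hP _ (hC.inter hB) (inter_subset_right.trans hBR)]
    rfl

end HalfLine

/-! ### Time averages -/

namespace HalfLine

open ProbabilityTheory

theorem timeAvg_eq_integral_expMeasure (A : ℝ → ℝ) {T : ℝ} (hT : 0 < T) :
    timeAvg A T = ∫ t, A t ∂(expMeasure (2 / T)) := by
  have hpdf : ∀ t, (exponentialPDF (2 / T) t).toReal • A t
      = (Ici (0 : ℝ)).indicator (fun t => 2 / T * (Real.exp (-2 * t / T) * A t)) t := by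
    intro t
    rw [exponentialPDF_eq]
    by_cases ht : 0 ≤ t
    · rw [if_pos ht, indicator_of_mem (mem_Ici.mpr ht), ENNReal.toReal_ofReal (by positivity),
        smul_eq_mul, mul_assoc, show -(2 / T * t) = -2 * t / T by ring]
    · simp [ht]
  rw [show expMeasure (2 / T) = volume.withDensity (exponentialPDF (2 / T)) from rfl,
    integral_withDensity_eq_integral_toReal_smul
      (f := exponentialPDF (2 / T)) (measurable_exponentialPDFReal _).ennreal_ofReal
      (ae_of_all _ fun _ => ENNReal.ofReal_lt_top)]
  simp only [hpdf]
  rw [integral_indicator measurableSet_Ici, integral_Ici_eq_integral_Ioi, integral_const_mul,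
    timeAvg]

/-- The Lorentzian `(1 + (Tx/2)²)⁻¹ = (2/T) ∫₀^∞ e^{-2t/T} cos(xt) dt`. -/
noncomputable def lorentzKernel (T x : ℝ) : ℝ := (1 + (T * x / 2) ^ 2)⁻¹

theorem lorentzKernel_nonneg (T x : ℝ) : 0 ≤ lorentzKernel T x := by
  unfold lorentzKernel
  positivity

theorem lorentzKernel_le_one (T x : ℝ) : lorentzKernel T x ≤ 1 :=
  inv_le_one_of_one_le₀ (by nlinarith [sq_nonneg (T * x / 2)])

theorem timeAvg_cos {T : ℝ} (hT : 0 < T) (x : ℝ) :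
    timeAvg (fun t => Real.cos (x * t)) T = lorentzKernel T x := by
  let z : ℂ := ⟨-(2 / T), x⟩
  have hz : z.re < 0 := by
    simp only [z, Left.neg_neg_iff]
    positivity
  have hre : ∀ t : ℝ, Real.exp (-2 * t / T) * Real.cos (x * t) = (Complex.exp (z * t)).re := by
    intro t
    rw [Complex.exp_re]
    simp only [z, Complex.mul_re, Complex.mul_im, Complex.ofReal_re, Complex.ofReal_im, mul_zero,
      sub_zero, zero_add]
    ring_nf
  have hint : ∫ t in Ioi (0 : ℝ), (Complex.exp (z * t)).re
      = (∫ t in Ioi (0 : ℝ), Complex.exp (z * t)).re :=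
    integral_re (integrableOn_exp_mul_complex_Ioi hz 0)
  rw [timeAvg]
  simp only [hre]
  rw [hint, integral_exp_mul_complex_Ioi hz]
  simp only [lorentzKernel, z, Complex.ofReal_zero, mul_zero, Complex.exp_zero, Complex.div_re,
    Complex.neg_re, Complex.neg_im, Complex.one_re, Complex.one_im, Complex.normSq_apply]
  field_simp
  ring

theorem norm_integral_exp_mul_sq {m : Measure ℝ} [SFinite m] {u : ℝ → ℝ} (hu : Integrable u m)
    (t : ℝ) : ‖∫ E, Complex.exp (-Complex.I * (E : ℂ) * (t : ℂ)) * (u E : ℂ) ∂m‖ ^ 2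
      = ∫ p, u p.1 * u p.2 * Real.cos ((p.1 - p.2) * t) ∂(m.prod m) := by
  set e : ℝ → ℂ := fun E => Complex.exp (-Complex.I * (E : ℂ) * (t : ℂ)) * (u E : ℂ) with he
  have hint : Integrable e m :=
    hu.ofReal.bdd_mul (SpectralCalc.measurable_exp_neg_I_mul t).aestronglyMeasurable
      (ae_of_all _ fun x => (SpectralCalc.norm_exp_neg_I_mul x t).le)
  have hconj : Integrable (fun E => (starRingEnd ℂ) (e E)) m :=
    Complex.conjCLE.toContinuousLinearMap.integrable_comp hint
  have hre : ∀ p : ℝ × ℝ, (e p.1 * (starRingEnd ℂ) (e p.2)).re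
      = u p.1 * u p.2 * Real.cos ((p.1 - p.2) * t) := by
    intro p
    have hexp : e p.1 * (starRingEnd ℂ) (e p.2)
        = ((u p.1 * u p.2 : ℝ) : ℂ) * Complex.exp (((-((p.1 - p.2) * t) : ℝ) : ℂ) * Complex.I) := by
      simp only [he, map_mul, ← Complex.exp_conj, map_neg, Complex.conj_I, Complex.conj_ofReal]
      rw [mul_mul_mul_comm, ← Complex.exp_add]
      push_cast
      ring_nf
    rw [hexp, Complex.re_ofReal_mul, Complex.exp_ofReal_mul_I_re, Real.cos_neg]
  calc ‖∫ E, e E ∂m‖ ^ 2 = ((∫ E, e E ∂m) * (starRingEnd ℂ) (∫ E, e E ∂m)).re := by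
        rw [Complex.mul_conj, Complex.normSq_eq_norm_sq, Complex.ofReal_re]
    _ = (∫ p, e p.1 * (starRingEnd ℂ) (e p.2) ∂(m.prod m)).re := by
        rw [← integral_conj, ← integral_prod_mul e fun E => (starRingEnd ℂ) (e E)]
    _ = ∫ p, u p.1 * u p.2 * Real.cos ((p.1 - p.2) * t) ∂(m.prod m) := by
        simp only [← hre]
        exact (integral_re (hint.mul_prod hconj)).symm

theorem integrable_mul_mul_cos {m : Measure ℝ} [SFinite m] {u : ℝ → ℝ} (hu : Integrable u m)
    (ν : Measure ℝ) [IsFiniteMeasure ν] :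
    Integrable (fun q : ℝ × ℝ × ℝ => u q.2.1 * u q.2.2 * Real.cos ((q.2.1 - q.2.2) * q.1))
      (ν.prod (m.prod m)) :=
  ((hu.mul_prod hu).comp_snd ν).mul_bdd (c := 1) (Continuous.aestronglyMeasurable (by fun_prop))
    (ae_of_all _ fun _ => Real.abs_cos_le_one _)

theorem integrable_norm_integral_exp_mul_sq {m : Measure ℝ} [SFinite m] {u : ℝ → ℝ}
    (hu : Integrable u m) (ν : Measure ℝ) [IsFiniteMeasure ν] :
    Integrable (fun t : ℝ =>
      ‖∫ E, Complex.exp (-Complex.I * (E : ℂ) * (t : ℂ)) * (u E : ℂ) ∂m‖ ^ 2) ν := by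
  simpa only [norm_integral_exp_mul_sq hu] using (integrable_mul_mul_cos hu ν).integral_prod_left

theorem timeAvg_norm_integral_exp_mul_sq {m : Measure ℝ} [SFinite m] {u : ℝ → ℝ}
    (hu : Integrable u m) {T : ℝ} (hT : 0 < T) :
    timeAvg (fun t => ‖∫ E, Complex.exp (-Complex.I * (E : ℂ) * (t : ℂ)) * (u E : ℂ) ∂m‖ ^ 2) T
      = ∫ p, u p.1 * u p.2 * lorentzKernel T (p.1 - p.2) ∂(m.prod m) := by
  have := isProbabilityMeasure_expMeasure (r := 2 / T) (by positivity)
  simp only [timeAvg_eq_integral_expMeasure _ hT, norm_integral_exp_mul_sq hu]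
  rw [integral_integral_swap (integrable_mul_mul_cos hu _)]
  simp only [integral_const_mul]
  simp only [← timeAvg_eq_integral_expMeasure _ hT, timeAvg_cos hT]

theorem integral_mul_kernel_le {X : Type*} [MeasurableSpace X] {m : Measure X} [IsFiniteMeasure m]
    {u : X → ℝ} (hu : MemLp u 2 m) {k : X → X → ℝ} (hk : Measurable fun p : X × X => k p.1 p.2)
    (h0 : ∀ x y, 0 ≤ k x y) {c : ℝ} (hc : ∀ x y, k x y ≤ c) (hsymm : ∀ x y, k x y = k y x) :
    ∫ p, u p.1 * u p.2 * k p.1 p.2 ∂(m.prod m) ≤ ∫ x, u x ^ 2 * ∫ y, k x y ∂m ∂m := by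
  have hu1 := hu.integrable one_le_two
  have hbdd : ∀ p : X × X, ‖k p.1 p.2‖ ≤ c := fun p =>
    (Real.norm_of_nonneg (h0 p.1 p.2)).trans_le (hc p.1 p.2)
  have hmul : Integrable (fun p : X × X => u p.1 * u p.2 * k p.1 p.2) (m.prod m) :=
    (hu1.mul_prod hu1).mul_bdd hk.aestronglyMeasurable (ae_of_all _ hbdd)
  have hfst : Integrable (fun p : X × X => u p.1 ^ 2 * k p.1 p.2) (m.prod m) :=
    (hu.integrable_sq.comp_fst m).mul_bdd hk.aestronglyMeasurable (ae_of_all _ hbdd)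
  have hswap : ((fun p : X × X => u p.1 ^ 2 * k p.1 p.2) ∘ Prod.swap)
      = fun p : X × X => u p.2 ^ 2 * k p.1 p.2 := funext fun p => by
    simp only [Function.comp_apply, Prod.fst_swap, Prod.snd_swap, hsymm p.2]
  have hsnd : Integrable (fun p : X × X => u p.2 ^ 2 * k p.1 p.2) (m.prod m) := hswap ▸ hfst.swap
  have hle : ∀ p : X × X, u p.1 * u p.2 * k p.1 p.2
      ≤ 2⁻¹ * (u p.1 ^ 2 * k p.1 p.2) + 2⁻¹ * (u p.2 ^ 2 * k p.1 p.2) := fun p => by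
    nlinarith [mul_nonneg (sq_nonneg (u p.1 - u p.2)) (h0 p.1 p.2)]
  have hint : ∫ p : X × X, u p.2 ^ 2 * k p.1 p.2 ∂(m.prod m)
      = ∫ p : X × X, u p.1 ^ 2 * k p.1 p.2 ∂(m.prod m) := by
    rw [← hswap]
    exact integral_prod_swap (μ := m) (ν := m) fun p : X × X => u p.1 ^ 2 * k p.1 p.2
  calc ∫ p, u p.1 * u p.2 * k p.1 p.2 ∂(m.prod m)
      ≤ ∫ p : X × X, (2⁻¹ * (u p.1 ^ 2 * k p.1 p.2) + 2⁻¹ * (u p.2 ^ 2 * k p.1 p.2)) ∂(m.prod m) :=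
        integral_mono hmul ((hfst.const_mul _).add (hsnd.const_mul _)) hle
    _ = ∫ p : X × X, u p.1 ^ 2 * k p.1 p.2 ∂(m.prod m) := by
        rw [integral_add (hfst.const_mul _) (hsnd.const_mul _), integral_const_mul,
          integral_const_mul, hint]
        ring
    _ = ∫ x, u x ^ 2 * ∫ y, k x y ∂m ∂m := by
        rw [integral_prod _ hfst]
        simp only [integral_const_mul]

end HalfLine

/-! ### The truncated norm -/

namespace HalfLine

/-- The weight of the site `k + 1` in `‖·‖_L²`. -/
noncomputable def truncWeight (L : ℝ) (k : ℕ) : ℝ := max 0 (min 1 (L - k))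

theorem truncWeight_nonneg (L : ℝ) (k : ℕ) : 0 ≤ truncWeight L k := le_max_left _ _

theorem truncWeight_le_one (L : ℝ) (k : ℕ) : truncWeight L k ≤ 1 :=
  max_le zero_le_one (min_le_left _ _)

theorem monotone_truncWeight (k : ℕ) : Monotone fun L => truncWeight L k := fun _ _ h =>
  max_le_max_left _ (min_le_min_left _ (sub_le_sub_right h _))

section Norm

variable {F : Type*} [Norm F]

theorem truncNormSq_eq_sum (φ : ℕ → F) {L : ℝ} (hL : 0 ≤ L) {N : ℕ} (hN : ⌊L⌋₊ < N) :
    truncNormSq φ L = ∑ k ∈ Finset.range N, truncWeight L k * ‖φ (k + 1)‖ ^ 2 := by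
  have hone : ∀ k ∈ Finset.range ⌊L⌋₊, truncWeight L k * ‖φ (k + 1)‖ ^ 2 = ‖φ (k + 1)‖ ^ 2 := by
    intro k hk
    have hkL : (k : ℝ) + 1 ≤ L := by
      exact_mod_cast (Nat.le_floor_iff hL).mp (Finset.mem_range.mp hk)
    rw [truncWeight, min_eq_left (by linarith), max_eq_right zero_le_one, one_mul]
  have hfloor : truncWeight L ⌊L⌋₊ = L - ⌊L⌋₊ := by
    rw [truncWeight, min_eq_right (by linarith [Nat.lt_floor_add_one L]),
      max_eq_right (sub_nonneg.mpr (Nat.floor_le hL))]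
  have hzero : ∀ k ∈ Finset.range N, k ∉ Finset.range (⌊L⌋₊ + 1) →
      truncWeight L k * ‖φ (k + 1)‖ ^ 2 = 0 := by
    intro k _ hk
    have hLk : L < k := Nat.lt_of_floor_lt (by simpa using hk)
    rw [truncWeight, max_eq_left ((min_le_right _ _).trans (by linarith)), zero_mul]
  rw [← Finset.sum_subset (Finset.range_subset_range.mpr hN) hzero, Finset.sum_range_succ,
    Finset.sum_congr rfl hone, hfloor, truncNormSq, Finset.range_eq_Ico,
    Finset.sum_Ico_add' (fun n => ‖φ n‖ ^ 2)]
  rfl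

theorem truncNormSq_nonneg (φ : ℕ → F) {L : ℝ} (hL : 0 ≤ L) : 0 ≤ truncNormSq φ L := by
  rw [truncNormSq_eq_sum φ hL (Nat.lt_succ_self _)]
  exact Finset.sum_nonneg fun k _ => mul_nonneg (truncWeight_nonneg L k) (sq_nonneg _)

theorem truncNormSq_mono (φ : ℕ → F) {L M : ℝ} (hL : 0 ≤ L) (hLM : L ≤ M) :
    truncNormSq φ L ≤ truncNormSq φ M := by
  rw [truncNormSq_eq_sum φ hL (Nat.lt_succ_of_le (Nat.floor_le_floor hLM)),
    truncNormSq_eq_sum φ (hL.trans hLM) (Nat.lt_succ_self _)]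
  gcongr with k
  exact monotone_truncWeight k hLM

theorem truncNormSq_of_lt_one (φ : ℕ → F) {L : ℝ} (hL : L < 1) :
    truncNormSq φ L = L * ‖φ 1‖ ^ 2 := by
  simp [truncNormSq, Nat.floor_eq_zero.mpr hL]

end Norm

theorem truncNormSq_add_le {F : Type*} [SeminormedAddCommGroup F] (φ χ : ℕ → F) {L : ℝ}
    (hL : 0 ≤ L) : truncNormSq (φ + χ) L ≤ 2 * truncNormSq φ L + 2 * truncNormSq χ L := by
  have hsq : ∀ n, ‖φ n + χ n‖ ^ 2 ≤ 2 * ‖φ n‖ ^ 2 + 2 * ‖χ n‖ ^ 2 := fun n =>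
    calc ‖φ n + χ n‖ ^ 2 ≤ (‖φ n‖ + ‖χ n‖) ^ 2 := by gcongr; exact norm_add_le _ _
      _ ≤ 2 * ‖φ n‖ ^ 2 + 2 * ‖χ n‖ ^ 2 := by linarith [add_sq_le (a := ‖φ n‖) (b := ‖χ n‖)]
  simp only [truncNormSq_eq_sum _ hL (Nat.lt_succ_self _), Finset.mul_sum,
    ← Finset.sum_add_distrib, Pi.add_apply]
  refine Finset.sum_le_sum fun k _ => ?_
  calc truncWeight L k * ‖φ (k + 1) + χ (k + 1)‖ ^ 2
      ≤ truncWeight L k * (2 * ‖φ (k + 1)‖ ^ 2 + 2 * ‖χ (k + 1)‖ ^ 2) :=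
        mul_le_mul_of_nonneg_left (hsq _) (truncWeight_nonneg L k)
    _ = 2 * (truncWeight L k * ‖φ (k + 1)‖ ^ 2) + 2 * (truncWeight L k * ‖χ (k + 1)‖ ^ 2) := by
        ring

theorem truncNormSq_atSite_le (ψ : L2) {L : ℝ} (hL : 0 ≤ L) :
    truncNormSq (atSite ψ) L ≤ ‖ψ‖ ^ 2 := by
  rw [truncNormSq_eq_sum _ hL (Nat.lt_succ_self _)]
  calc ∑ k ∈ Finset.range (⌊L⌋₊ + 1), truncWeight L k * ‖atSite ψ (k + 1)‖ ^ 2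
      ≤ ∑ k ∈ Finset.range (⌊L⌋₊ + 1), ‖ψ k‖ ^ 2 := Finset.sum_le_sum fun k _ =>
        mul_le_of_le_one_left (sq_nonneg _) (truncWeight_le_one L k)
    _ ≤ ‖ψ‖ ^ 2 := by
        simpa using lp.sum_rpow_le_norm_rpow (p := 2) (by norm_num) ψ (Finset.range (⌊L⌋₊ + 1))

theorem atSite_add (φ χ : ℕ → ℂ) : atSite (φ + χ) = atSite φ + atSite χ := by
  funext n
  cases n <;> simp [atSite]

theorem atSite_zero : atSite 0 = 0 := by
  funext n
  cases n <;> rfl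

theorem continuous_truncNormSq_dirichletSol (a v : ℕ → ℝ) (L : ℝ) :
    Continuous fun E => truncNormSq (dirichletSol a v E) L := by
  have := continuous_dirichletSol a v
  unfold truncNormSq
  fun_prop

theorem one_le_truncNormSq {u : ℕ → ℝ} (hu : u 1 = 1) {L : ℝ} (hL : 1 ≤ L) :
    1 ≤ truncNormSq u L :=
  calc (1 : ℝ) = truncNormSq u 1 := by simp [truncNormSq, hu]
    _ ≤ truncNormSq u L := truncNormSq_mono u zero_le_one hL

end HalfLine

namespace HalfLine

open ProbabilityTheory

/-- `∫ (1 + (T(E - x)/2)²)⁻¹ dμ(x)`, which measures the mass of `μ` at distance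
of order `1/T` from `E`. -/
noncomputable def lorentzAverage (μ : Measure ℝ) (T E : ℝ) : ℝ := ∫ x, lorentzKernel T (E - x) ∂μ

theorem lorentzAverage_nonneg (μ : Measure ℝ) (T E : ℝ) : 0 ≤ lorentzAverage μ T E :=
  integral_nonneg fun _ => lorentzKernel_nonneg _ _

theorem continuous_lorentzKernel : Continuous (Function.uncurry lorentzKernel) :=
  Continuous.inv₀ (by fun_prop) fun p => (by positivity : 0 < 1 + (p.1 * p.2 / 2) ^ 2).ne'

theorem norm_lorentzKernel_le_one (T x : ℝ) : ‖lorentzKernel T x‖ ≤ 1 :=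
  (Real.norm_of_nonneg (lorentzKernel_nonneg T x)).trans_le (lorentzKernel_le_one T x)

theorem measurable_lorentzKernel_sub (T : ℝ) :
    Measurable fun p : ℝ × ℝ => lorentzKernel T (p.1 - p.2) :=
  (continuous_lorentzKernel.comp
    (continuous_const.prodMk (continuous_fst.sub continuous_snd))).measurable

variable (μ : Measure ℝ) [IsFiniteMeasure μ]

theorem integrable_lorentzKernel (T E : ℝ) : Integrable (fun E' => lorentzKernel T (E - E')) μ :=
  .of_bound ((measurable_lorentzKernel_sub T).comp measurable_prodMk_left).aestronglyMeasurable 1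
    (ae_of_all _ fun _ => norm_lorentzKernel_le_one _ _)

theorem lorentzAverage_le (T E : ℝ) : lorentzAverage μ T E ≤ μ.real univ :=
  (integral_mono (integrable_lorentzKernel μ T E) (integrable_const 1) fun _ =>
    lorentzKernel_le_one _ _).trans_eq (by simp)

theorem lorentzAverage_restrict_le (B : Set ℝ) (T E : ℝ) :
    lorentzAverage (μ.restrict B) T E ≤ lorentzAverage μ T E :=
  setIntegral_le_integral (integrable_lorentzKernel μ T E)
    (ae_of_all _ fun _ => lorentzKernel_nonneg _ _)

theorem continuous_lorentzAverage (T : ℝ) : Continuous (lorentzAverage μ T) :=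
  continuous_of_dominated (bound := fun _ => 1)
    (fun E => (integrable_lorentzKernel μ T E).aestronglyMeasurable)
    (fun _ => ae_of_all _ fun _ => norm_lorentzKernel_le_one _ _) (integrable_const 1)
    (ae_of_all _ fun _ => continuous_lorentzKernel.comp
      (continuous_const.prodMk (continuous_id.sub continuous_const)))

variable {μ}

theorem timeAvg_norm_integral_exp_mul_sq_le {u : ℝ → ℝ} (hu : MemLp u 2 μ) {T : ℝ} (hT : 0 < T) :
    timeAvg (fun t => ‖∫ E, Complex.exp (-Complex.I * (E : ℂ) * (t : ℂ)) * (u E : ℂ) ∂μ‖ ^ 2) T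
      ≤ ∫ E, u E ^ 2 * lorentzAverage μ T E ∂μ := by
  rw [timeAvg_norm_integral_exp_mul_sq (hu.integrable one_le_two) hT]
  exact integral_mul_kernel_le hu (measurable_lorentzKernel_sub T)
    (fun _ _ => lorentzKernel_nonneg _ _) (fun _ _ => lorentzKernel_le_one _ _)
    fun x y => by rw [lorentzKernel, lorentzKernel, ← neg_sub y x, mul_neg, neg_div, neg_sq]

theorem integrable_truncNormSq_integral_exp_mul {u : ℕ → ℝ → ℝ} (hu : ∀ n, Integrable (u n) μ)
    {L : ℝ} (hL : 0 ≤ L) (ν : Measure ℝ) [IsFiniteMeasure ν] :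
    Integrable (fun t : ℝ => truncNormSq
      (fun n => ∫ E, Complex.exp (-Complex.I * (E : ℂ) * (t : ℂ)) * (u n E : ℂ) ∂μ) L) ν := by
  simp only [truncNormSq_eq_sum _ hL (Nat.lt_succ_self _)]
  exact integrable_finsetSum _ fun k _ =>
    (integrable_norm_integral_exp_mul_sq (hu (k + 1)) ν).const_mul _

theorem timeAvg_truncNormSq_integral_exp_mul_le {u : ℕ → ℝ → ℝ} (hu : ∀ n, MemLp (u n) 2 μ)
    {L : ℝ} (hL : 0 ≤ L) {T : ℝ} (hT : 0 < T) :
    timeAvg (fun t => truncNormSq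
        (fun n => ∫ E, Complex.exp (-Complex.I * (E : ℂ) * (t : ℂ)) * (u n E : ℂ) ∂μ) L) T
      ≤ ∫ E, truncNormSq (fun n => u n E) L * lorentzAverage μ T E ∂μ := by
  have := isProbabilityMeasure_expMeasure (r := 2 / T) (by positivity)
  have hint : ∀ n, Integrable (fun E => u n E ^ 2 * lorentzAverage μ T E) μ := fun n =>
    (hu n).integrable_sq.mul_bdd (continuous_lorentzAverage μ T).aestronglyMeasurable
      (ae_of_all _ fun E => (Real.norm_of_nonneg (lorentzAverage_nonneg μ T E)).trans_le
        (lorentzAverage_le μ T E))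
  have hsite := fun n => timeAvg_norm_integral_exp_mul_sq_le (hu n) hT
  simp only [timeAvg_eq_integral_expMeasure _ hT, truncNormSq_eq_sum _ hL (Nat.lt_succ_self _)]
    at hsite ⊢
  rw [integral_finsetSum _ fun k _ =>
    (integrable_norm_integral_exp_mul_sq ((hu (k + 1)).integrable one_le_two) _).const_mul _]
  simp only [Finset.sum_mul, mul_assoc (truncWeight _ _), Real.norm_eq_abs, sq_abs]
  rw [integral_finsetSum _ fun k _ => (hint (k + 1)).const_mul _]
  simp only [integral_const_mul]
  gcongr with k
  · exact truncWeight_nonneg L k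
  · exact hsite (k + 1)

theorem memLp_two_of_continuous {f : ℝ → ℝ} (hf : Continuous f) (μ : Measure ℝ)
    [IsFiniteMeasureOnCompacts μ] {R : ℝ} {B : Set ℝ} (hBR : B ⊆ Icc (-R) R) :
    MemLp f 2 (μ.restrict B) :=
  (memLp_two_iff_integrable_sq hf.aestronglyMeasurable).mpr
    (((hf.pow 2).continuousOn.integrableOn_compact isCompact_Icc).mono_set hBR)

/-- `‖e^{-iH₊t} P_B δ₁‖_L²`: the mass that the part of `δ₁` with energies in `B` has, at time `t`,
within distance `L` of the origin. -/
noncomputable def massInside (a v : ℕ → ℝ) (B : Set ℝ) (L t : ℝ) : ℝ :=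
  truncNormSq (atSite (SpectralCalc.evolution (jacobiOp a v) t
    (SpectralCalc.spectralProj (jacobiOp a v) B delta1))) L

theorem massInside_eq {a v : ℕ → ℝ} (ha : ∀ n, 1 ≤ n → a n ≠ 0)
    (hA : ∃ P, SpectralCalc.IsSpectralResolution (jacobiOp a v) P) {R : ℝ} {B : Set ℝ}
    (hB : MeasurableSet B) (hBR : B ⊆ Icc (-R) R) (L : ℝ) :
    massInside a v B L = fun t : ℝ => truncNormSq (fun n =>
      ∫ E in B, Complex.exp (-Complex.I * (E : ℂ) * (t : ℂ)) * (dirichletSol a v E n : ℂ)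
        ∂(muPlus a v)) L :=
  funext fun t => congrArg (truncNormSq · L) <|
    funext fun n => atSite_evolution_proj_delta1 ha hA n hB hBR t

theorem integrable_massInside {a v : ℕ → ℝ} (ha : ∀ n, 1 ≤ n → a n ≠ 0)
    (hA : ∃ P, SpectralCalc.IsSpectralResolution (jacobiOp a v) P) {R : ℝ} {B : Set ℝ}
    (hB : MeasurableSet B) (hBR : B ⊆ Icc (-R) R) {L : ℝ} (hL : 0 ≤ L)
    (ν : Measure ℝ) [IsFiniteMeasure ν] :
    Integrable (massInside a v B L) ν := by
  rw [massInside_eq ha hA hB hBR L]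
  exact integrable_truncNormSq_integral_exp_mul (fun n =>
    (memLp_two_of_continuous (continuous_dirichletSol a v n) (muPlus a v) hBR).integrable
      one_le_two) hL ν

theorem timeAvg_massInside_le {a v : ℕ → ℝ} (ha : ∀ n, 1 ≤ n → a n ≠ 0)
    (hA : ∃ P, SpectralCalc.IsSpectralResolution (jacobiOp a v) P) {R : ℝ} {B : Set ℝ}
    (hB : MeasurableSet B) (hBR : B ⊆ Icc (-R) R) {L : ℝ} (hL : 0 ≤ L) {T : ℝ} (hT : 0 < T)
    {δ : ℝ} (hδ : ∀ E ∈ B,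
      truncNormSq (dirichletSol a v E) L * lorentzAverage (muPlus a v) T E ≤ δ) :
    timeAvg (massInside a v B L) T ≤ δ * (muPlus a v).real B := by
  rw [massInside_eq ha hA hB hBR L]
  calc _ ≤ ∫ E in B, truncNormSq (dirichletSol a v E) L
        * lorentzAverage ((muPlus a v).restrict B) T E ∂(muPlus a v) :=
        timeAvg_truncNormSq_integral_exp_mul_le (fun n =>
          memLp_two_of_continuous (continuous_dirichletSol a v n) (muPlus a v) hBR) hL hT
    _ ≤ ∫ _ in B, δ ∂(muPlus a v) := by
        refine integral_mono_of_nonneg (ae_of_all _ fun E =>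
          mul_nonneg (truncNormSq_nonneg _ hL) (lorentzAverage_nonneg _ _ _)) (integrable_const δ)
          (ae_restrict_of_forall_mem hB fun E hE => le_trans ?_ (hδ E hE))
        exact mul_le_mul_of_nonneg_left (lorentzAverage_restrict_le _ B T E)
          (truncNormSq_nonneg _ hL)
    _ = δ * (muPlus a v).real B := by
        rw [setIntegral_const, smul_eq_mul, mul_comm]

end HalfLine

/-! ### Power bounds from the upper derivative and the growth of solutions -/

namespace HalfLine

variable {μ : Measure ℝ} {s E : ℝ}

theorem exists_eventually_measureReal_Ioo_le (h : upperDeriv μ s E < ⊤) :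
    ∃ C : ℝ, ∀ᶠ ε in 𝓝[>] (0 : ℝ), μ.real (Ioo (E - ε) (E + ε)) ≤ C * ε ^ s := by
  obtain ⟨K, hK, hKtop⟩ := exists_between h
  refine ⟨K.toReal * 2 ^ s, ?_⟩
  filter_upwards [eventually_lt_of_limsup_lt hK, self_mem_nhdsWithin] with ε hε (hε0 : 0 < ε)
  have hpos : 0 < (2 * ε) ^ s := by positivity
  have hle := (ENNReal.div_le_iff (ENNReal.ofReal_pos.mpr hpos).ne' ENNReal.ofReal_ne_top).mp hε.le
  calc μ.real (Ioo (E - ε) (E + ε)) ≤ (K * ENNReal.ofReal ((2 * ε) ^ s)).toReal :=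
        ENNReal.toReal_mono (by finiteness) hle
    _ = K.toReal * 2 ^ s * ε ^ s := by
        rw [ENNReal.toReal_mul, ENNReal.toReal_ofReal hpos.le,
          Real.mul_rpow zero_le_two hε0.le, mul_assoc]

variable [IsFiniteMeasure μ]

theorem exists_measureReal_Ioo_le (hs : 0 ≤ s) (h : upperDeriv μ s E < ⊤) :
    ∃ C : ℝ, ∀ ε > 0, μ.real (Ioo (E - ε) (E + ε)) ≤ C * ε ^ s := by
  obtain ⟨C, hC⟩ := exists_eventually_measureReal_Ioo_le h
  obtain ⟨ε₀, hε₀ : 0 < ε₀, hlocal⟩ := mem_nhdsGT_iff_exists_Ioo_subset.mp hC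
  refine ⟨max C (μ.real univ / ε₀ ^ s), fun ε hε => ?_⟩
  rcases lt_or_ge ε ε₀ with hlt | hge
  · calc μ.real (Ioo (E - ε) (E + ε)) ≤ C * ε ^ s := hlocal ⟨hε, hlt⟩
      _ ≤ _ := by gcongr; exact le_max_left _ _
  · calc μ.real (Ioo (E - ε) (E + ε)) ≤ μ.real univ := measureReal_mono (subset_univ _)
      _ = μ.real univ / ε₀ ^ s * ε₀ ^ s := by field_simp
      _ ≤ _ := by gcongr; exact le_max_right _ _

theorem ae_exists_eventually_le_measureReal_Ioo (μ : Measure ℝ) [IsFiniteMeasure μ] :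
    ∀ᵐ E ∂μ, ∃ K : ℝ, ∀ᶠ ε in 𝓝[>] (0 : ℝ), ε ≤ K * μ.real (Ioo (E - ε) (E + ε)) := by
  filter_upwards [Besicovitch.ae_tendsto_rnDeriv volume μ, Measure.rnDeriv_lt_top volume μ]
    with E hE hlt
  obtain ⟨K, hK, hKtop⟩ := exists_between hlt
  have hhalf : Tendsto (fun ε : ℝ => ε / 2) (𝓝[>] 0) (𝓝[>] 0) :=
    tendsto_nhdsWithin_iff.mpr ⟨tendsto_nhdsWithin_of_tendsto_nhds
      (Continuous.tendsto' (by fun_prop) _ _ (zero_div 2)),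
      eventually_mem_nhdsWithin.mono fun _ h => mem_Ioi.mpr (half_pos h)⟩
  refine ⟨K.toReal, ?_⟩
  filter_upwards [hhalf.eventually (hE.eventually_lt_const hK), self_mem_nhdsWithin]
    with ε hε (hε0 : 0 < ε)
  rw [Real.volume_closedBall, mul_div_cancel₀ _ two_ne_zero] at hε
  have hne : μ (Metric.closedBall E (ε / 2)) ≠ 0 := by
    rintro h
    simp [h, ENNReal.div_zero, hε0] at hε
  have hle := (ENNReal.div_le_iff hne (measure_ne_top _ _)).mp hε.le
  calc ε = (ENNReal.ofReal ε).toReal := (ENNReal.toReal_ofReal hε0.le).symm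
    _ ≤ (K * μ (Metric.closedBall E (ε / 2))).toReal := ENNReal.toReal_mono (by finiteness) hle
    _ = K.toReal * μ.real (Metric.closedBall E (ε / 2)) := ENNReal.toReal_mul
    _ ≤ K.toReal * μ.real (Ioo (E - ε) (E + ε)) := by
        rw [← Real.ball_eq_Ioo]
        gcongr
        · finiteness
        · exact Metric.closedBall_subset_ball (half_lt_self hε0)

theorem tendsto_rpow_nhdsGT_zero {p : ℝ} (hp : 0 < p) :
    Tendsto (fun x : ℝ => x ^ p) (𝓝[>] 0) (𝓝 0) := by
  have hcont := (Real.continuousAt_rpow_const 0 p (Or.inr hp.le)).tendsto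
  rw [Real.zero_rpow hp.ne'] at hcont
  exact hcont.mono_left nhdsWithin_le_nhds

theorem ae_le_one_of_upperDeriv_lt_top (μ : Measure ℝ) [IsFiniteMeasure μ] :
    ∀ᵐ E ∂μ, ∀ s, upperDeriv μ s E < ⊤ → s ≤ 1 := by
  filter_upwards [ae_exists_eventually_le_measureReal_Ioo μ] with E ⟨K, hK⟩ s hs
  obtain ⟨C, hC⟩ := exists_eventually_measureReal_Ioo_le hs
  by_contra! h1
  have hlim : Tendsto (fun ε : ℝ => |K| * C * ε ^ (s - 1)) (𝓝[>] 0) (𝓝 0) := by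
    simpa using (tendsto_rpow_nhdsGT_zero (sub_pos.mpr h1)).const_mul (|K| * C)
  obtain ⟨ε, ⟨hlow, hup, hlt⟩, hε : 0 < ε⟩ :=
    ((hK.and (hC.and (hlim.eventually_lt_const one_pos))).and self_mem_nhdsWithin).exists
  have : ε < ε := calc
    ε ≤ |K| * μ.real (Ioo (E - ε) (E + ε)) := hlow.trans (by gcongr; exact le_abs_self K)
    _ ≤ |K| * (C * ε ^ s) := by gcongr
    _ = |K| * C * ε ^ (s - 1) * ε := by rw [Real.rpow_sub_one hε.ne']; field_simp
    _ < 1 * ε := by gcongr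
    _ = ε := one_mul ε
  exact this.false

theorem setOf_lt_lorentzKernel_subset {T t : ℝ} (hT : 0 < T) (ht : 0 < t) :
    {E' | t < lorentzKernel T (E - E')}
      ⊆ Ioo (E - 2 / T * t ^ (-1 / 2 : ℝ)) (E + 2 / T * t ^ (-1 / 2 : ℝ)) := by
  intro E' (hE' : t < lorentzKernel T (E - E'))
  have hinv : 1 + (T * (E - E') / 2) ^ 2 < t⁻¹ := by
    rwa [lorentzKernel, lt_inv_comm₀ ht (by positivity)] at hE'
  have hroot : (t ^ (-1 / 2 : ℝ)) ^ 2 = t⁻¹ := by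
    rw [← Real.rpow_natCast, ← Real.rpow_mul ht.le, ← Real.rpow_neg_one]
    norm_num
  have habs : |T * (E - E') / 2| < t ^ (-1 / 2 : ℝ) :=
    abs_lt_of_sq_lt_sq (by linarith) (by positivity)
  have hdist : |E' - E| < 2 / T * t ^ (-1 / 2 : ℝ) := by
    rw [abs_div, abs_mul, abs_of_pos hT, abs_two, abs_sub_comm] at habs
    rw [div_mul_eq_mul_div, lt_div_iff₀ hT]
    linarith
  rwa [← Real.ball_eq_Ioo, Metric.mem_ball, Real.dist_eq]

theorem exists_lorentzAverage_le {C : ℝ} (hs : s < 2)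
    (hC : ∀ ε > 0, μ.real (Ioo (E - ε) (E + ε)) ≤ C * ε ^ s) :
    ∃ C' : ℝ, ∀ T > 0, lorentzAverage μ T E ≤ C' * T ^ (-s) := by
  refine ⟨C * 2 ^ s * ∫ t in Ioo (0 : ℝ) 1, t ^ (-s / 2), fun T hT => ?_⟩
  have hint : IntegrableOn (fun t : ℝ => C * (2 / T) ^ s * t ^ (-s / 2)) (Ioo 0 1) :=
    ((intervalIntegral.integrableOn_Ioo_rpow_iff one_pos).mpr (by linarith)).const_mul _
  have hlevel : ∀ t ∈ Ioi (0 : ℝ), μ.real {E' | t < lorentzKernel T (E - E')}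
      ≤ (Ioo 0 1).indicator (fun t : ℝ => C * (2 / T) ^ s * t ^ (-s / 2)) t := by
    intro t (ht : 0 < t)
    by_cases ht1 : t < 1
    · rw [indicator_of_mem (show t ∈ Ioo 0 1 from ⟨ht, ht1⟩)]
      calc μ.real {E' | t < lorentzKernel T (E - E')}
          ≤ C * (2 / T * t ^ (-1 / 2 : ℝ)) ^ s :=
            (measureReal_mono (setOf_lt_lorentzKernel_subset hT ht)).trans (hC _ (by positivity))
        _ = C * (2 / T) ^ s * t ^ (-s / 2) := by
            rw [Real.mul_rpow (by positivity) (by positivity), ← Real.rpow_mul ht.le, mul_assoc]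
            ring_nf
    · have hempty : {E' | t < lorentzKernel T (E - E')} = ∅ := eq_empty_of_forall_notMem fun E' h =>
        ht1 (h.trans_le (lorentzKernel_le_one _ _))
      rw [hempty, measureReal_empty, indicator_of_notMem fun h => ht1 h.2]
  calc lorentzAverage μ T E = ∫ t in Ioi 0, μ.real {E' | t < lorentzKernel T (E - E')} :=
        (integrable_lorentzKernel μ T E).integral_eq_integral_meas_lt
          (ae_of_all _ fun _ => lorentzKernel_nonneg _ _)
    _ ≤ ∫ t in Ioi 0, (Ioo 0 1).indicator (fun t : ℝ => C * (2 / T) ^ s * t ^ (-s / 2)) t :=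
        integral_mono_of_nonneg (ae_of_all _ fun _ => measureReal_nonneg)
          (hint.integrable_indicator measurableSet_Ioo).restrict
          (ae_restrict_of_forall_mem measurableSet_Ioi hlevel)
    _ = C * 2 ^ s * (∫ t in Ioo (0 : ℝ) 1, t ^ (-s / 2)) * T ^ (-s) := by
        rw [setIntegral_indicator measurableSet_Ioo, inter_eq_right.mpr Ioo_subset_Ioi_self,
          integral_const_mul, Real.div_rpow zero_le_two hT.le, Real.rpow_neg hT.le]
        ring

theorem nonneg_and_exists_truncNormSq_le {u : ℕ → ℝ} (hu : u 1 = 1) {γ : ℝ}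
    (h : limsup (fun L : ℝ => ENNReal.ofReal (L ^ (-γ) * truncNormSq u L)) atTop < ⊤) :
    0 ≤ γ ∧ ∃ C : ℝ, ∀ L ≥ 1, truncNormSq u L ≤ C * L ^ γ := by
  obtain ⟨K, hK, hKtop⟩ := exists_between h
  have hlarge : ∀ᶠ L : ℝ in atTop, truncNormSq u L ≤ K.toReal * L ^ γ := by
    filter_upwards [eventually_lt_of_limsup_lt hK, eventually_ge_atTop 1] with L hL hL1
    have hL0 : 0 < L := zero_lt_one.trans_le hL1
    have hle := (ENNReal.ofReal_le_iff_le_toReal hKtop.ne).mp hL.le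
    rwa [Real.rpow_neg hL0.le, inv_mul_le_iff₀ (by positivity), mul_comm] at hle
  have hγ : 0 ≤ γ := by
    by_contra! hneg
    have hlim : Tendsto (fun L : ℝ => K.toReal * L ^ γ) atTop (𝓝 0) := by
      simpa using (tendsto_rpow_neg_atTop (neg_pos.mpr hneg)).const_mul K.toReal
    obtain ⟨L, hL0, hL, hL1⟩ :=
      ((hlim.eventually_lt_const one_pos).and (hlarge.and (eventually_ge_atTop 1))).exists
    linarith [one_le_truncNormSq hu hL1]
  obtain ⟨L₀, hL₀⟩ := eventually_atTop.mp hlarge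
  refine ⟨hγ, max K.toReal (truncNormSq u L₀), fun L hL => ?_⟩
  rcases le_total L₀ L with hle | hle
  · calc truncNormSq u L ≤ K.toReal * L ^ γ := hL₀ L hle
      _ ≤ _ := by gcongr; exact le_max_left _ _
  · calc truncNormSq u L ≤ truncNormSq u L₀ := truncNormSq_mono u (by linarith) hle
      _ ≤ truncNormSq u L₀ * L ^ γ := le_mul_of_one_le_right
          (truncNormSq_nonneg u (by linarith)) (Real.one_le_rpow hL hγ)
      _ ≤ _ := by gcongr; exact le_max_right _ _

end HalfLine

/-! ### Escape from the ball of radius `C T^b` -/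

namespace HalfLine

open ProbabilityTheory

theorem truncNormSq_mul_le {u : ℕ → ℝ} (hu : u 1 = 1) {γ C : ℝ}
    (hC : ∀ L ≥ 1, truncNormSq u L ≤ C * L ^ γ) {p : ℝ} (hp1 : p ≤ 1) (hpγ : p ≤ γ)
    {r : ℝ} (hr0 : 0 < r) (hr1 : r ≤ 1) {R : ℝ} (hR : 1 ≤ R) :
    truncNormSq u (r * R) ≤ max 1 C * (r ^ p * R ^ γ) := by
  have hR0 : 0 < R := one_pos.trans_le hR
  rcases lt_or_ge (r * R) 1 with hlt | hge
  · calc truncNormSq u (r * R) = r * R := by simp [truncNormSq_of_lt_one u hlt, hu]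
      _ ≤ (r * R) ^ p := Real.self_le_rpow_of_le_one (by positivity) hlt.le hp1
      _ = r ^ p * R ^ p := Real.mul_rpow hr0.le hR0.le
      _ ≤ r ^ p * R ^ γ := by gcongr
      _ ≤ max 1 C * (r ^ p * R ^ γ) := le_mul_of_one_le_left (by positivity) (le_max_left 1 C)
  · calc truncNormSq u (r * R) ≤ C * (r * R) ^ γ := hC _ hge
      _ ≤ max 1 C * (r * R) ^ γ := by gcongr; exact le_max_right 1 C
      _ = max 1 C * (r ^ γ * R ^ γ) := by rw [Real.mul_rpow hr0.le hR0.le]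
      _ ≤ max 1 C * (r ^ p * R ^ γ) := by
        gcongr ?_ * (?_ * _)
        exact Real.rpow_le_rpow_of_exponent_ge hr0 hr1 hpγ

theorem truncNormSq_mul_lorentzAverage_le {μ : Measure ℝ} [IsFiniteMeasure μ] {u : ℕ → ℝ}
    (hu : u 1 = 1) {γ C : ℝ} (hC : ∀ L ≥ 1, truncNormSq u L ≤ C * L ^ γ) {α K E : ℝ}
    (hK : ∀ T > 0, lorentzAverage μ T E ≤ K * T ^ (-α)) {b : ℝ} (hb : 0 ≤ b) (hbγ : b * γ ≤ α)
    {r : ℝ} (hr0 : 0 < r) (hr1 : r < 1) {T : ℝ} (hT : 0 < T) :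
    truncNormSq u (r * T ^ b) * lorentzAverage μ T E
      ≤ (μ.real univ + max 1 C * K) * r ^ min γ 1 := by
  have hK0 : 0 ≤ K := by simpa using (lorentzAverage_nonneg μ 1 E).trans (hK 1 one_pos)
  have hmax : 0 ≤ max 1 C := zero_le_one.trans (le_max_left 1 C)
  rcases le_total T 1 with hT1 | hT1
  · have hL : r * T ^ b ≤ r := mul_le_of_le_one_right hr0.le (Real.rpow_le_one hT.le hT1 hb)
    calc truncNormSq u (r * T ^ b) * lorentzAverage μ T E
        ≤ r ^ min γ 1 * μ.real univ := by
          gcongr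
          · exact lorentzAverage_nonneg μ T E
          · rw [truncNormSq_of_lt_one u (hL.trans_lt hr1), hu, norm_one, one_pow, mul_one]
            exact hL.trans (Real.self_le_rpow_of_le_one hr0.le hr1.le (min_le_right γ 1))
          · exact lorentzAverage_le μ T E
      _ ≤ (μ.real univ + max 1 C * K) * r ^ min γ 1 := by
          rw [mul_comm]
          gcongr
          exact le_add_of_nonneg_right (mul_nonneg hmax hK0)
  · have hTα : (T ^ b) ^ γ * T ^ (-α) ≤ 1 := by
      rw [← Real.rpow_mul hT.le, ← Real.rpow_add hT]
      exact Real.rpow_le_one_of_one_le_of_nonpos hT1 (by linarith)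
    calc truncNormSq u (r * T ^ b) * lorentzAverage μ T E
        ≤ (max 1 C * (r ^ min γ 1 * (T ^ b) ^ γ)) * (K * T ^ (-α)) := by
          gcongr
          · exact lorentzAverage_nonneg μ T E
          · exact truncNormSq_mul_le hu hC (min_le_right γ 1) (min_le_left γ 1) hr0 hr1.le
              (Real.one_le_rpow hT1 hb)
          · exact hK T hT
      _ = max 1 C * K * r ^ min γ 1 * ((T ^ b) ^ γ * T ^ (-α)) := by ring
      _ ≤ max 1 C * K * r ^ min γ 1 := mul_le_of_le_one_right (by positivity) hTα
      _ ≤ (μ.real univ + max 1 C * K) * r ^ min γ 1 := by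
          gcongr
          exact le_add_of_nonneg_left measureReal_nonneg

theorem eventually_truncNormSq_mul_lorentzAverage_le {μ : Measure ℝ} [IsFiniteMeasure μ]
    {u : ℕ → ℝ} (hu : u 1 = 1) {α γ E : ℝ} (hα : α ≤ 1) (hD : upperDeriv μ α E < ⊤)
    (hG : limsup (fun L : ℝ => ENNReal.ofReal (L ^ (-γ) * truncNormSq u L)) atTop < ⊤)
    {b : ℝ} (hb : 0 < b) (hη : b ≤ α / γ) {δ : ℝ} (hδ : 0 < δ) :
    ∀ᶠ r in 𝓝[>] (0 : ℝ), ∀ T > 0, truncNormSq u (r * T ^ b) * lorentzAverage μ T E ≤ δ := by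
  obtain ⟨hγ0, C, hC⟩ := nonneg_and_exists_truncNormSq_le hu hG
  have hγ : 0 < γ := hγ0.lt_of_ne' (by rintro rfl; linarith [div_zero α])
  have hbγ : b * γ ≤ α := (le_div_iff₀ hγ).mp hη
  obtain ⟨D, hD⟩ := exists_measureReal_Ioo_le ((mul_pos hb hγ).le.trans hbγ) hD
  obtain ⟨K, hK⟩ := exists_lorentzAverage_le (by linarith) hD
  have hlim : Tendsto (fun r : ℝ => (μ.real univ + max 1 C * K) * r ^ min γ 1) (𝓝[>] 0) (𝓝 0) := by
    simpa using (tendsto_rpow_nhdsGT_zero (lt_min hγ one_pos)).const_mul (μ.real univ + max 1 C * K)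
  filter_upwards [hlim.eventually_lt_const hδ, Ioo_mem_nhdsGT one_pos] with r hrδ ⟨hr0, hr1⟩ T hT
  exact (truncNormSq_mul_lorentzAverage_le hu hC hK hb.le hbγ hr0 hr1 hT).trans hrδ.le

/-- The energies in `[-n, n]` whose contribution to the mass that the time evolution leaves in the
ball of radius `T^b / (n + 1)` is at most `δ`, uniformly in `T`. -/
def goodSet (a v : ℕ → ℝ) (b δ : ℝ) (n : ℕ) : Set ℝ :=
  {E ∈ Icc (-(n : ℝ)) n | ∀ T > 0,
    truncNormSq (dirichletSol a v E) (((n : ℝ) + 1)⁻¹ * T ^ b)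
      * lorentzAverage (muPlus a v) T E ≤ δ}

variable (a v : ℕ → ℝ) (b δ : ℝ)

theorem measurableSet_goodSet (n : ℕ) : MeasurableSet (goodSet a v b δ n) := by
  simp only [goodSet, ofPred_and, ofPred_forall]
  exact (isClosed_Icc.inter (isClosed_biInter fun T _ => isClosed_le
    ((continuous_truncNormSq_dirichletSol a v _).mul (continuous_lorentzAverage _ T))
    continuous_const)).measurableSet

theorem monotone_goodSet : Monotone (goodSet a v b δ) := by
  intro m n hmn E ⟨hE, hδ⟩
  have hcast : (m : ℝ) ≤ n := Nat.cast_le.mpr hmn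
  refine ⟨Icc_subset_Icc (neg_le_neg hcast) hcast hE, fun T hT => le_trans ?_ (hδ T hT)⟩
  gcongr
  · exact lorentzAverage_nonneg _ T E
  · exact truncNormSq_mono _ (by positivity) (by gcongr)

variable {a v b δ}

theorem exists_mem_goodSet {E : ℝ}
    (h : ∀ᶠ r in 𝓝[>] (0 : ℝ), ∀ T > 0,
      truncNormSq (dirichletSol a v E) (r * T ^ b) * lorentzAverage (muPlus a v) T E ≤ δ) :
    ∃ n, E ∈ goodSet a v b δ n := by
  have hr : Tendsto (fun n : ℕ => ((n : ℝ) + 1)⁻¹) atTop (𝓝[>] 0) :=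
    tendsto_inv_atTop_nhdsGT_zero.comp
      (tendsto_atTop_add_const_right _ _ tendsto_natCast_atTop_atTop)
  obtain ⟨n, hn, hE⟩ := ((hr.eventually h).and
    (tendsto_natCast_atTop_atTop.eventually_ge_atTop |E|)).exists
  exact ⟨n, abs_le.mp hE, hn⟩

theorem exists_measureReal_diff_lt {X : Type*} [MeasurableSpace X] {μ : Measure X}
    [IsFiniteMeasure μ] {S : Set X} (hS : MeasurableSet S) {G : ℕ → Set X}
    (hG : ∀ n, MeasurableSet (G n)) (hmono : Monotone G) (h : ∀ᵐ x ∂μ, x ∈ S → ∃ n, x ∈ G n)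
    {κ : ℝ} (hκ : 0 < κ) : ∃ n, μ.real (S \ G n) < κ := by
  have hnull : μ (⋂ n, S \ G n) = 0 := by
    refine measure_mono_null (fun x hx => ?_) (ae_iff.mp h)
    simp only [mem_iInter, Set.mem_sdiff] at hx
    simpa using ⟨(hx 0).1, fun n => (hx n).2⟩
  have hlim := tendsto_measure_iInter_atTop (μ := μ) (fun n => (hS.diff (hG n)).nullMeasurableSet)
    (fun m n hmn => sdiff_subset_sdiff_right (hmono hmn)) ⟨0, measure_ne_top _ _⟩
  rw [hnull] at hlim
  obtain ⟨n, hn⟩ := (hlim.eventually_lt_const (ENNReal.ofReal_pos.mpr hκ)).exists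
  exact ⟨n, (ENNReal.lt_ofReal_iff_toReal_lt (measure_ne_top _ _)).mp hn⟩

theorem timeAvg_le_two_mul_add {f g : ℝ → ℝ} {c T : ℝ} (hT : 0 < T) (hf : ∀ t, 0 ≤ f t)
    (hg : Integrable g (expMeasure (2 / T))) (h : ∀ t, f t ≤ 2 * g t + c) :
    timeAvg f T ≤ 2 * timeAvg g T + c := by
  have := isProbabilityMeasure_expMeasure (r := 2 / T) (by positivity)
  simp only [timeAvg_eq_integral_expMeasure _ hT]
  calc ∫ t, f t ∂(expMeasure (2 / T)) ≤ ∫ t, (2 * g t + c) ∂(expMeasure (2 / T)) :=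
        integral_mono_of_nonneg (ae_of_all _ hf) ((hg.const_mul 2).add (integrable_const c))
          (ae_of_all _ h)
    _ = 2 * ∫ t, g t ∂(expMeasure (2 / T)) + c := by
        rw [integral_add (hg.const_mul 2) (integrable_const c), integral_const_mul,
          integral_const, probReal_univ, one_smul]

theorem massInside_le_two_mul_add (hA : ∃ P, SpectralCalc.IsSpectralResolution (jacobiOp a v) P)
    {S B : Set ℝ} (hS : MeasurableSet S) (hB : MeasurableSet B) (hBS : B ⊆ S) {L : ℝ} (hL : 0 ≤ L)
    (t : ℝ) :
    massInside a v S L t ≤ 2 * massInside a v B L t + 2 * (muPlus a v).real (S \ B) := by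
  have hP := (SpectralCalc.isSpectralResolution_spectralProj hA).isPVM
  have hsplit : SpectralCalc.spectralProj (jacobiOp a v) S delta1
      = SpectralCalc.spectralProj (jacobiOp a v) B delta1
        + SpectralCalc.spectralProj (jacobiOp a v) (S \ B) delta1 := by
    rw [← hP.apply_union hB (hS.diff hB) disjoint_sdiff_right, union_sdiff_cancel hBS]
  rw [massInside, hsplit, map_add, lp.coeFn_add, atSite_add]
  refine (truncNormSq_add_le _ _ hL).trans <|
    add_le_add le_rfl (mul_le_mul_of_nonneg_left ?_ zero_le_two)
  calc _ ≤ ‖SpectralCalc.evolution (jacobiOp a v) t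
          (SpectralCalc.spectralProj (jacobiOp a v) (S \ B) delta1)‖ ^ 2 :=
          truncNormSq_atSite_le _ hL
    _ ≤ ‖SpectralCalc.spectralProj (jacobiOp a v) (S \ B) delta1‖ ^ 2 := by
          gcongr
          exact SpectralCalc.norm_evolution_le hA t _
    _ = (muPlus a v).real (S \ B) := hP.norm_sq_apply (hS.diff hB) delta1

theorem timeAvg_massInside_le_add (ha : ∀ n, 1 ≤ n → a n ≠ 0)
    (hA : ∃ P, SpectralCalc.IsSpectralResolution (jacobiOp a v) P) {S : Set ℝ}
    (hS : MeasurableSet S) {R : ℝ} {B : Set ℝ} (hB : MeasurableSet B) (hBS : B ⊆ S)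
    (hBR : B ⊆ Icc (-R) R) {L : ℝ} (hL : 0 ≤ L) {T : ℝ} (hT : 0 < T) :
    timeAvg (massInside a v S L) T
      ≤ 2 * timeAvg (massInside a v B L) T + 2 * (muPlus a v).real (S \ B) :=
  have := isProbabilityMeasure_expMeasure (r := 2 / T) (by positivity)
  timeAvg_le_two_mul_add hT (fun _ => truncNormSq_nonneg _ hL)
    (integrable_massInside ha hA hB hBR hL _) (massInside_le_two_mul_add hA hS hB hBS hL)

end HalfLine

namespace HalfLine

theorem measureReal_muPlus_le_one (a v : ℕ → ℝ) (s : Set ℝ) : (muPlus a v).real s ≤ 1 := by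
  by_cases hP : SpectralCalc.IsPVM (SpectralCalc.spectralProj (jacobiOp a v))
  · calc (muPlus a v).real s ≤ (muPlus a v).real univ := measureReal_mono (subset_univ s)
      _ = 1 := by
        rw [muPlus, SpectralCalc.spectralMeasure, hP.pvmMeasure_real_univ, delta1,
          lp.norm_single zero_lt_two, norm_one, one_pow]
  · simp [muPlus, SpectralCalc.spectralMeasure, SpectralCalc.pvmMeasure, hP]

-- An operator without a spectral resolution is assigned zero spectral projections.
theorem timeAvg_massInside_of_not_exists {a v : ℕ → ℝ}
    (hA : ¬ ∃ P, SpectralCalc.IsSpectralResolution (jacobiOp a v) P) (S : Set ℝ) (L T : ℝ) :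
    timeAvg (massInside a v S L) T = 0 := by
  have h : massInside a v S L = fun _ => truncNormSq (0 : ℕ → ℂ) L := funext fun t =>
    congrArg (truncNormSq · L) <| by
      rw [SpectralCalc.spectralProj, dif_neg hA, Pi.zero_apply, zero_apply, map_zero]
      exact atSite_zero
  simp [h, truncNormSq, timeAvg]

end HalfLine

theorem theorem1p4_general (a v : ℕ → ℝ) (ha : ∀ n, 1 ≤ n → a n ≠ 0)
    (hA : ∃ P, SpectralCalc.IsSpectralResolution (HalfLine.jacobiOp a v) P) (α γ : ℝ → ℝ)
    (hD : ∀ᵐ E ∂(HalfLine.muPlus a v), HalfLine.upperDeriv (HalfLine.muPlus a v) (α E) E < ⊤)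
    (hG : ∀ᵐ E ∂(HalfLine.muPlus a v),
      limsup (fun L : ℝ => ENNReal.ofReal
        (L ^ (-γ E) * HalfLine.truncNormSq (HalfLine.dirichletSol a v E) L)) atTop < ⊤)
    (S : Set ℝ) (hS : MeasurableSet S) (b : ℝ) (hb : 0 < b) (hη : ∀ E ∈ S, b ≤ α E / γ E)
    (g : ℝ) (hg : 0 < g) :
    ∃ C : ℝ, 0 < C ∧ ∀ T : ℝ, 0 < T →
      HalfLine.timeAvg (HalfLine.massInside a v S (C * T ^ b)) T ≤ g := by
  have hgood : ∀ᵐ E ∂(HalfLine.muPlus a v), E ∈ S → ∃ n, E ∈ HalfLine.goodSet a v b (g / 4) n := by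
    filter_upwards [hD, hG, HalfLine.ae_le_one_of_upperDeriv_lt_top (HalfLine.muPlus a v)]
      with E hDE hGE hle hES
    exact HalfLine.exists_mem_goodSet <|
      HalfLine.eventually_truncNormSq_mul_lorentzAverage_le rfl (hle _ hDE) hDE hGE hb (hη E hES)
        (by positivity)
  have hmeas := HalfLine.measurableSet_goodSet a v b (g / 4)
  obtain ⟨n, hn⟩ := HalfLine.exists_measureReal_diff_lt hS hmeas
    (HalfLine.monotone_goodSet a v b (g / 4)) hgood (κ := g / 4) (by positivity)
  refine ⟨((n : ℝ) + 1)⁻¹, by positivity, fun T hT => ?_⟩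
  have hB : MeasurableSet (S ∩ HalfLine.goodSet a v b (g / 4) n) := hS.inter (hmeas n)
  have hBn : S ∩ HalfLine.goodSet a v b (g / 4) n ⊆ Icc (-(n : ℝ)) n := fun _ hE => hE.2.1
  have hL : 0 ≤ ((n : ℝ) + 1)⁻¹ * T ^ b := by positivity
  have hout := HalfLine.timeAvg_massInside_le_add ha hA hS hB inter_subset_left hBn hL hT
  have hin := HalfLine.timeAvg_massInside_le ha hA hB hBn hL hT fun E hE => hE.2.2 T hT
  have hle := HalfLine.measureReal_muPlus_le_one a v (S ∩ HalfLine.goodSet a v b (g / 4) n)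
  rw [sdiff_self_inter] at hout
  nlinarith

theorem theorem1p4
    -- the coefficients of `H₊`
    (a v : ℕ → ℝ) (ha : ∀ n, 1 ≤ n → a n ≠ 0)
    (hsum : ¬ Summable fun n : ℕ => |a (n + 1)|⁻¹)
    -- the exponents `α(E)` and `γ(E)`
    (α γ : ℝ → ℝ) (hα : Measurable α) (hγ : Measurable γ)
    (hD : ∀ᵐ E ∂(HalfLine.muPlus a v), HalfLine.upperDeriv (HalfLine.muPlus a v) (α E) E < ⊤)
    (hG : ∀ᵐ E ∂(HalfLine.muPlus a v),
      limsup (fun L : ℝ => ENNReal.ofReal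
        (L ^ (-γ E) * HalfLine.truncNormSq (HalfLine.dirichletSol a v E) L)) atTop < ⊤)
    (S : Set ℝ) (hS : MeasurableSet S) (b : ℝ) (hb : 0 < b)
    (hη : ∀ E ∈ S, b ≤ α E / γ E) :
    ∀ g : ℝ, 0 < g → ∃ C : ℝ, 0 < C ∧ ∀ T : ℝ, 0 < T →
      HalfLine.timeAvg (fun t => HalfLine.truncNormSq
          (HalfLine.atSite (SpectralCalc.evolution (HalfLine.jacobiOp a v) t
            (SpectralCalc.spectralProj (HalfLine.jacobiOp a v) S HalfLine.delta1)))
          (C * T ^ b)) T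
        ≤ 1 - (HalfLine.muPlus a v).real {E | b ≤ α E / γ E} + g := by
  intro g hg
  have hμ := HalfLine.measureReal_muPlus_le_one a v {E | b ≤ α E / γ E}
  by_cases hA : ∃ P, SpectralCalc.IsSpectralResolution (HalfLine.jacobiOp a v) P
  · obtain ⟨C, hC, h⟩ := theorem1p4_general a v ha hA α γ hD hG S hS b hb hη g hg
    exact ⟨C, hC, fun T hT => (h T hT).trans (by linarith)⟩
  · exact ⟨1, one_pos, fun T _ =>
      (HalfLine.timeAvg_massInside_of_not_exists hA S (1 * T ^ b) T).trans_le (by linarith)⟩
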